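/- **Conventions.** All spaces below (spaces of units and arrows of groupoids, groups, total spaces $Z$) are locally compact Hausdorff. A *Real* structure on a space is a continuous involution. A *Real groupoid* $(\mathcal G,\rho)$ is a topological groupoid $\mathcal G\rightrightarrows X$ with a Real structure that is a strict automorphism of $\mathcal G$; a *Real group* $(S,\bar{\ })$ is a topological group with a continuous involutive automorphism (written multiplicatively), and is viewed as a Real groupoid with one unit. A *Real generalized homomorphism* $(Z,\tau):(\mathcal G,\rho)\to(S,\bar{\ })$ is a Real space $(Z,\tau)$ with a continuous open surjective map $\mathfrak r:Z\to X$ satisfying $\mathfrak r(\tau(z))=\rho(\mathfrak r(z))$, a continuous left action of $\mathcal G$ along $\mathfrak r$ and a commuting continuous right action of $S$ preserving the fibres of $\mathfrak r$, such that $\tau(gz)=\rho(g)\tau(z)$, $\tau(zt)=\tau(z)\bar t$, and such that $\mathfrak r:Z\to X$ is a locally trivial principal $S$-bundle: it has continuous local sections, $(z,t)\mapsto(z,zt)$ is a homeomorphism $Z\times S\to Z\times_XZ$, and $Z$ is locally isomorphic to $U\times S$ as an $S$-bundle. $\operatorname{Hom}_{\mathfrak{RG}}(\mathcal G,S)$ is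 the set of isomorphism classes $[Z,\tau]$, isomorphisms being the $\mathcal G$-$S$-equivariant homeomorphisms over $X$ that intertwine the involutions. Let $\mathcal G_n$ be the space of strings of $n$ composable arrows of $\mathcal G$, i.e. of strict homomorphisms from the pair groupoid of $[n]=\{0,\dots,n\}$ to $\mathcal G$, with its involution $\rho_n$, and let $\tilde f:\mathcal G_n\to\mathcal G_m$ be the map induced by $f:[m]\to[n]$. Let $\varepsilon_k:[n]\to[n+1]$ be the increasing map that avoids $k$. A *Real open cover* of a Real space is an open cover $(U_j)_{j\in J}$ whose index set carries an involution $j\mapsto\bar j$ such that $U_{\bar j}$ is the image of $U_j$ under the Real structure; a Real open cover $\mathcal U=(\mathcal U_n)_n$ of $\mathcal G_\bullet$ is a sequence of Real open covers $\mathcal U_n=(U^n_j)_{j\in J_n}$ of $\mathcal G_n$. Its associated pre-simplicial cover ${}_\natural\mathcal U$ is indexed by the families $\lambda=(\lambda_\varphi)\in\Lambda_n$, $\lambda_\varphi\in J_k$ for $\varphi:[k]\to[n]$ strictly increasing, with $U^n_\lambda=\bigcap_\varphi\tilde\varphi^{-1}(U^k_{\lambda_\varphi})$, $(\bar\lambda)_\varphi=\overline{\lambda_\varphi}$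 and $(\tilde f\lambda)_\varphi=\lambda_{f\circ\varphi}$. A *Real $n$-cochain* is a family of continuous maps $c_\lambda:U^n_\lambda\to S$, $\lambda\in\Lambda_n$, with $c_{\bar\lambda}(\rho_n(x))=\overline{c_\lambda(x)}$; write $(\tilde f^*c)_\lambda=c_{\tilde f\lambda}\circ\tilde f$. A $1$-cochain $c$ is a *cocycle* if $\tilde\varepsilon_1^*c=\tilde\varepsilon_2^*c\cdot\tilde\varepsilon_0^*c$, and cocycles $c,c'$ are *cohomologous* if $c'=(\tilde\varepsilon_1^*\varphi)^{-1}\cdot c\cdot\tilde\varepsilon_0^*\varphi$ for a Real $0$-cochain $\varphi$; $HR^1(\mathcal U,S)$ is the set of cohomology classes, which for abelian $S$ is an abelian group (cocycles modulo coboundaries). Finally $$\check HR^1(\mathcal G_\bullet,S)=\varinjlim_{\mathcal U\in\mathfrak N(1)}HR^1(\mathcal U,S),$$ where $\mathfrak N(1)$ consists of the Real open covers $\mathcal U$ of $\mathcal G_\bullet$ such that for some $N\ge2$ the index sets $J_n$, $n\le N$, carry an action $\tilde f:J_n\to J_m$ of all nondecreasing maps $f:[m]\to[n]$, $m,n\le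 N$, functorial and compatible with the involutions, with $\tilde f(U^n_j)\subseteq U^m_{\tilde f(j)}$; and where the transition maps are restrictions along refinements (maps $\theta_n$ of index sets that commute with the involutions and satisfy $V^n_i\subseteq U^n_{\theta_n(i)}$). Every Real generalized homomorphism $(Z,\tau):\mathcal G\to S$ has, for some $\mathcal U\in\mathfrak N(1)$, continuous local sections $\mathsf s_\lambda:U^0_\lambda\to Z$ of $\mathfrak r$ ($\lambda\in\Lambda_0$) with $\mathsf s_{\bar\lambda}\circ\rho=\tau\circ\mathsf s_\lambda$, together with a Real $1$-cocycle $c$ over ${}_\natural\mathcal U$, called a *transition cocycle* of $Z$, such that, with $\lambda_0=\tilde\varepsilon_1\lambda$ and $\lambda_1=\tilde\varepsilon_0\lambda$, $$g\cdot\mathsf s_{\lambda_1}(s(g))=\mathsf s_{\lambda_0}(r(g))\cdot c_\lambda(g)\qquad(\lambda\in\Lambda_1,\ g\in U^1_\lambda).$$ **Proposition.** Let $(\mathcal G,\rho)$ be a Real groupoid with unit space $X$. 1. Let $S$ be an abelian Real group (with trivial $\mathcal G$-action). Then $\operatorname{Hom}_{\mathfrak{RG}}(\mathcal G,S)$ is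 an abelian group under $$[Z,\tau]+[Z',\tau']=[\,Z\times_XZ'/\!\sim,\ \tau\times\tau'\,],\qquad (z,z')\sim(zt^{-1},z't)\ \ (t\in S),$$ with actions $g[z,z']=[gz,gz']$ and $[z,z']t=[z,z't]$, the inverse of $[Z,\tau]$ being the class of $(Z,\tau)$ with the same left action and with right action $z\cdot t:=zt^{-1}$. There is a group isomorphism $\operatorname{Hom}_{\mathfrak{RG}}(\mathcal G,S)\cong\check HR^1(\mathcal G_\bullet,S)$ that sends $[Z,\tau]$ to the class of any transition cocycle of $Z$. 2. Let $S$ be any Real group, not necessarily abelian. Then there is a bijection from the set $\operatorname{Hom}_{\mathfrak{RG}}(\mathcal G,S)$ onto the set $\check HR^1(\mathcal G_\bullet,S)$ that sends $[Z,\tau]$ to the class of any transition cocycle of $Z$. -/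

import Mathlib

open Set Topology

universe u

/-- A locally compact Hausdorff topological groupoid `Arr ⇉ Obj`, together with a Real structure,
i.e. an involutive homeomorphic strict automorphism (`ρ₀` on units, `ρ` on arrows).
The arrow `g` goes from `s g` to `r g`, and `mul g h` is defined when `s g = r h`. -/
structure RealGroupoid where
  Obj : Type u
  Arr : Type u
  [topObj : TopologicalSpace Obj]
  [topArr : TopologicalSpace Arr]
  [t2Obj : T2Space Obj]
  [t2Arr : T2Space Arr]
  [lcObj : LocallyCompactSpace Obj]
  [lcArr : LocallyCompactSpace Arr]
  r : Arr → Obj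
  s : Arr → Obj
  unit : Obj → Arr
  inv : Arr → Arr
  mul : ∀ g h : Arr, s g = r h → Arr
  r_unit : ∀ x, r (unit x) = x
  s_unit : ∀ x, s (unit x) = x
  r_inv : ∀ g, r (inv g) = s g
  s_inv : ∀ g, s (inv g) = r g
  r_mul : ∀ g h (e : s g = r h), r (mul g h e) = r g
  s_mul : ∀ g h (e : s g = r h), s (mul g h e) = s h
  mul_assoc : ∀ g h k (e : s g = r h) (e' : s h = r k),
    mul (mul g h e) k ((s_mul g h e).trans e') = mul g (mul h k e') (e.trans (r_mul h k e').symm)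
  unit_mul : ∀ g, mul (unit (r g)) g (s_unit (r g)) = g
  mul_unit : ∀ g, mul g (unit (s g)) (r_unit (s g)).symm = g
  inv_mul : ∀ g, mul (inv g) g (s_inv g) = unit (s g)
  mul_inv : ∀ g, mul g (inv g) (r_inv g).symm = unit (r g)
  continuous_r : Continuous r
  continuous_s : Continuous s
  continuous_unit : Continuous unit
  continuous_inv : Continuous inv
  continuous_mul : Continuous fun p : {p : Arr × Arr // s p.1 = r p.2} => mul p.1.1 p.1.2 p.2
  ρ₀ : Obj → Obj
  ρ : Arr → Arr
  continuous_ρ₀ : Continuous ρ₀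
  continuous_ρ : Continuous ρ
  ρ₀_ρ₀ : ∀ x, ρ₀ (ρ₀ x) = x
  ρ_ρ : ∀ g, ρ (ρ g) = g
  r_ρ : ∀ g, r (ρ g) = ρ₀ (r g)
  s_ρ : ∀ g, s (ρ g) = ρ₀ (s g)
  ρ_unit : ∀ x, ρ (unit x) = unit (ρ₀ x)
  ρ_mul : ∀ g h (e : s g = r h),
    ρ (mul g h e) = mul (ρ g) (ρ h) (((s_ρ g).trans (congrArg ρ₀ e)).trans (r_ρ h).symm)

/-- A Real group: a locally compact Hausdorff topological group with a continuous involutive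
automorphism `conj`. -/
class RealGroup (S : Type u) [Group S] [TopologicalSpace S] extends
    IsTopologicalGroup S, T2Space S, LocallyCompactSpace S where
  conj : S →* S
  continuous_conj : Continuous conj
  conj_conj : ∀ t, conj (conj t) = t

namespace RealGroupoid

attribute [instance] topObj topArr t2Obj t2Arr lcObj lcArr

/-- A Real group, seen as a Real groupoid with one unit. -/
def ofGroup (S : Type u) [Group S] [TopologicalSpace S] [RealGroup S] : RealGroupoid.{u} where
  Obj := PUnit.{u + 1}
  Arr := S
  r _ := PUnit.unit
  s _ := PUnit.unit
  unit _ := 1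
  inv t := t⁻¹
  mul t t' _ := t * t'
  r_unit _ := rfl
  s_unit _ := rfl
  r_inv _ := rfl
  s_inv _ := rfl
  r_mul _ _ _ := rfl
  s_mul _ _ _ := rfl
  mul_assoc a b c _ _ := _root_.mul_assoc a b c
  unit_mul := one_mul
  mul_unit := mul_one
  inv_mul := inv_mul_cancel
  mul_inv := mul_inv_cancel
  continuous_r := continuous_const
  continuous_s := continuous_const
  continuous_unit := continuous_const
  continuous_inv := ContinuousInv.continuous_inv
  continuous_mul := by fun_prop
  ρ₀ x := x
  ρ t := RealGroup.conj t
  continuous_ρ₀ := continuous_id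
  continuous_ρ := RealGroup.continuous_conj
  ρ₀_ρ₀ _ := rfl
  ρ_ρ := RealGroup.conj_conj
  r_ρ _ := rfl
  s_ρ _ := rfl
  ρ_unit _ := map_one _
  ρ_mul a b _ := map_mul _ a b

end RealGroupoid

/-- A locally compact Hausdorff Real space `(Z, τ)` with commuting Real actions: a left action of
`Γ` along `rng : Z → Γ.Obj` and a right action of `G` along `src : Z → G.Obj`, where `rng` is
invariant under `G` and `src` is invariant under `Γ`. -/
structure RealBibundle (Γ G : RealGroupoid.{u}) where
  Z : Type u
  [topZ : TopologicalSpace Z]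
  [t2Z : T2Space Z]
  [lcZ : LocallyCompactSpace Z]
  τ : Z → Z
  continuous_τ : Continuous τ
  τ_τ : ∀ z, τ (τ z) = z
  rng : Z → Γ.Obj
  src : Z → G.Obj
  continuous_rng : Continuous rng
  isOpenMap_rng : IsOpenMap rng
  surjective_rng : Function.Surjective rng
  continuous_src : Continuous src
  isOpenMap_src : IsOpenMap src
  rng_τ : ∀ z, rng (τ z) = Γ.ρ₀ (rng z)
  src_τ : ∀ z, src (τ z) = G.ρ₀ (src z)
  lact : ∀ (γ : Γ.Arr) (z : Z), Γ.s γ = rng z → Z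
  ract : ∀ (z : Z) (g : G.Arr), src z = G.r g → Z
  continuous_lact : Continuous fun p : {p : Γ.Arr × Z // Γ.s p.1 = rng p.2} =>
    lact p.1.1 p.1.2 p.2
  continuous_ract : Continuous fun p : {p : Z × G.Arr // src p.1 = G.r p.2} =>
    ract p.1.1 p.1.2 p.2
  rng_lact : ∀ γ z (e : Γ.s γ = rng z), rng (lact γ z e) = Γ.r γ
  src_lact : ∀ γ z (e : Γ.s γ = rng z), src (lact γ z e) = src z
  src_ract : ∀ z g (e : src z = G.r g), src (ract z g e) = G.s g
  rng_ract : ∀ z g (e : src z = G.r g), rng (ract z g e) = rng z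
  unit_lact : ∀ z, lact (Γ.unit (rng z)) z (Γ.s_unit _) = z
  ract_unit : ∀ z, ract z (G.unit (src z)) (G.r_unit _).symm = z
  mul_lact : ∀ γ γ' z (e : Γ.s γ = Γ.r γ') (e' : Γ.s γ' = rng z),
    lact (Γ.mul γ γ' e) z ((Γ.s_mul γ γ' e).trans e') =
      lact γ (lact γ' z e') (e.trans (rng_lact γ' z e').symm)
  ract_mul : ∀ z g g' (e : src z = G.r g) (e' : G.s g = G.r g'),
    ract z (G.mul g g' e') (e.trans (G.r_mul g g' e').symm) =
      ract (ract z g e) g' ((src_ract z g e).trans e')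
  lact_ract : ∀ γ z g (e : Γ.s γ = rng z) (e' : src z = G.r g),
    lact γ (ract z g e') (e.trans (rng_ract z g e').symm) =
      ract (lact γ z e) g ((src_lact γ z e).trans e')
  τ_lact : ∀ γ z (e : Γ.s γ = rng z),
    τ (lact γ z e) = lact (Γ.ρ γ) (τ z) (((Γ.s_ρ γ).trans (congrArg Γ.ρ₀ e)).trans (rng_τ z).symm)
  τ_ract : ∀ z g (e : src z = G.r g),
    τ (ract z g e) = ract (τ z) (G.ρ g) (((src_τ z).trans (congrArg G.ρ₀ e)).trans (G.r_ρ g).symm)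

namespace RealBibundle

attribute [instance] topZ t2Z lcZ

variable {Γ G : RealGroupoid.{u}}

/-- The map `(z, g) ↦ (z, zg)` from `Z ×_{src, r} G` to `Z ×_{rng} Z`. -/
def shear (Z : RealBibundle Γ G) (p : {p : Z.Z × G.Arr // Z.src p.1 = G.r p.2}) :
    {q : Z.Z × Z.Z // Z.rng q.1 = Z.rng q.2} :=
  ⟨(p.1.1, Z.ract p.1.1 p.1.2 p.2), (Z.rng_ract _ _ _).symm⟩

/-- `rng : Z → Γ.Obj` is a principal `G`-bundle: it is locally split, and `(z, g) ↦ (z, zg)` is a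
homeomorphism onto the fibred product. -/
def IsPrincipal (Z : RealBibundle Γ G) : Prop :=
  (∀ y : Γ.Obj, ∃ U : Set Γ.Obj, IsOpen U ∧ y ∈ U ∧
    ∃ σ : C(U, Z.Z), ∀ u, Z.rng (σ u) = u) ∧
  IsHomeomorph Z.shear

/-- `rng : Z → Γ.Obj` is locally, as a `G`-bundle, of the form `U ×_{φ, r} G` for a continuous map
`φ : U → G.Obj`. -/
def IsLocallyTrivial (Z : RealBibundle Γ G) : Prop :=
  ∀ y : Γ.Obj, ∃ U : Set Γ.Obj, IsOpen U ∧ y ∈ U ∧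
    ∃ (φ : C(U, G.Obj)) (h : {z : Z.Z // Z.rng z ∈ U} ≃ₜ {p : U × G.Arr // φ p.1 = G.r p.2})
      (hs : ∀ z, G.s (h z).1.2 = Z.src z.1),
      (∀ z, ((h z).1.1 : Γ.Obj) = Z.rng z.1) ∧
      ∀ z g (e : Z.src z.1 = G.r g),
        (h ⟨Z.ract z.1 g e, (Z.rng_ract _ _ _).symm ▸ z.2⟩).1.2 =
          G.mul (h z).1.2 g ((hs z).trans e)

end RealBibundle

/-- A Real generalized homomorphism from `Γ` to `G`. -/
structure RealGenHom (Γ G : RealGroupoid.{u}) extends RealBibundle Γ G where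
  isPrincipal : toRealBibundle.IsPrincipal
  isLocallyTrivial : toRealBibundle.IsLocallyTrivial

/-- Isomorphisms of Real generalized homomorphisms. -/
structure RealGenHom.Iso {Γ G : RealGroupoid.{u}} (Z Z' : RealGenHom Γ G) where
  f : Z.Z ≃ₜ Z'.Z
  rng_f : ∀ z, Z'.rng (f z) = Z.rng z
  src_f : ∀ z, Z'.src (f z) = Z.src z
  τ_f : ∀ z, f (Z.τ z) = Z'.τ (f z)
  f_lact : ∀ γ z (e : Γ.s γ = Z.rng z), f (Z.lact γ z e) = Z'.lact γ (f z) (e.trans (rng_f z).symm)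
  f_ract : ∀ z g (e : Z.src z = G.r g), f (Z.ract z g e) = Z'.ract (f z) g ((src_f z).trans e)

namespace RealGenHom

/-- Isomorphism is an equivalence relation. -/
instance isoSetoid (Γ G : RealGroupoid.{u}) : Setoid (RealGenHom Γ G) where
  r Z Z' := Nonempty (Iso Z Z')
  iseqv :=
    { refl := fun Z => ⟨{
        f := Homeomorph.refl _
        rng_f := fun _ => rfl
        src_f := fun _ => rfl
        τ_f := fun _ => rfl
        f_lact := fun _ _ _ => rfl
        f_ract := fun _ _ _ => rfl }⟩
      symm := fun {Z Z'} ⟨i⟩ => ⟨{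
        f := i.f.symm
        rng_f := fun z => by rw [← i.rng_f, i.f.apply_symm_apply]
        src_f := fun z => by rw [← i.src_f, i.f.apply_symm_apply]
        τ_f := fun z => i.f.injective (by rw [i.τ_f]; simp)
        f_lact := fun γ z e => i.f.injective (by rw [i.f_lact]; simp)
        f_ract := fun z g e => i.f.injective (by rw [i.f_ract]; simp) }⟩
      trans := fun {Z Z' Z''} ⟨i⟩ ⟨j⟩ => ⟨{
        f := i.f.trans j.f
        rng_f := fun z => (j.rng_f _).trans (i.rng_f z)
        src_f := fun z => (j.src_f _).trans (i.src_f z)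
        τ_f := fun z => by simp [i.τ_f, j.τ_f]
        f_lact := fun γ z e => by simp [i.f_lact, j.f_lact]
        f_ract := fun z g e => by simp [i.f_ract, j.f_ract] }⟩ }

end RealGenHom

/-- The set `Hom_RG(Γ, G)` of isomorphism classes of Real generalized homomorphisms. -/
def HomRG (Γ G : RealGroupoid.{u}) : Type (u + 1) :=
  Quotient (RealGenHom.isoSetoid Γ G)

/-- The isomorphism class of a Real generalized homomorphism. -/
def HomRG.mk {Γ G : RealGroupoid.{u}} (Z : RealGenHom Γ G) : HomRG Γ G :=
  Quotient.mk _ Z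

namespace RealBibundle

variable {Γ G : RealGroupoid.{u}}

theorem ract_congr (Z : RealBibundle Γ G) {z z' : Z.Z} {g g' : G.Arr} (hz : z = z') (hg : g = g')
    (e : Z.src z = G.r g) (e' : Z.src z' = G.r g') : Z.ract z g e = Z.ract z' g' e' := by
  subst hz hg; rfl

/-- For a principal bundle, the unique arrow `g` with `z g = w` depends continuously on the pair
`(z, w)` of points in the same fibre. -/
theorem IsPrincipal.exists_div {Z : RealBibundle Γ G} (hZ : Z.IsPrincipal) :
    ∃ d : {q : Z.Z × Z.Z // Z.rng q.1 = Z.rng q.2} → G.Arr, Continuous d ∧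
      (∀ q, ∃ e : Z.src q.1.1 = G.r (d q), Z.ract q.1.1 (d q) e = q.1.2) ∧
      ∀ q g (e : Z.src q.1.1 = G.r g), Z.ract q.1.1 g e = q.1.2 → d q = g := by
  obtain ⟨h, hh⟩ := isHomeomorph_iff_exists_homeomorph.1 hZ.2
  have key : ∀ q, (h.symm q).1.1 = q.1.1 ∧
      Z.ract (h.symm q).1.1 (h.symm q).1.2 (h.symm q).2 = q.1.2 := by
    intro q
    have := h.apply_symm_apply q
    rw [hh] at this
    exact ⟨congrArg (fun q => q.1.1) this, congrArg (fun q => q.1.2) this⟩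
  refine ⟨fun q => (h.symm q).1.2, by fun_prop, fun q => ?_, fun q g e hq => ?_⟩
  · obtain ⟨h1, h2⟩ := key q
    refine ⟨h1 ▸ (h.symm q).2, ?_⟩
    rw [← h2]
    exact Z.ract_congr h1.symm rfl _ _
  · have : h.symm q = ⟨(q.1.1, g), e⟩ := by
      rw [h.symm_apply_eq, hh]
      exact Subtype.ext (Prod.ext rfl hq.symm)
    show (h.symm _).1.2 = g
    rw [this]

theorem IsPrincipal.isLocallyTrivial {Z : RealBibundle Γ G} (hZ : Z.IsPrincipal) :
    Z.IsLocallyTrivial := by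
  obtain ⟨d, hd, hd1, hd2⟩ := hZ.exists_div
  choose e he using hd1
  intro y
  obtain ⟨U, hU, hy, σ, hσ⟩ := hZ.1 y
  have hz : ∀ z : {z : Z.Z // Z.rng z ∈ U}, Z.rng (σ ⟨_, z.2⟩) = Z.rng z.1 := fun z => hσ _
  have hs : ∀ z : {z : Z.Z // Z.rng z ∈ U}, G.s (d ⟨(σ ⟨_, z.2⟩, z.1), hz z⟩) = Z.src z.1 := by
    intro z
    rw [← Z.src_ract _ _ (e ⟨(σ ⟨_, z.2⟩, z.1), hz z⟩), he]
  refine ⟨U, hU, hy, ⟨fun u => Z.src (σ u), Z.continuous_src.comp σ.continuous⟩,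
    { toFun := fun z => ⟨(⟨_, z.2⟩, d ⟨(σ ⟨_, z.2⟩, z.1), hz z⟩), e ⟨(σ ⟨_, z.2⟩, z.1), hz z⟩⟩
      invFun := fun p => ⟨Z.ract (σ p.1.1) p.1.2 p.2, by
        rw [Z.rng_ract, hσ]; exact p.1.1.2⟩
      left_inv := fun z => Subtype.ext (he ⟨(σ ⟨_, z.2⟩, z.1), hz z⟩)
      right_inv := ?_
      continuous_toFun := ?_
      continuous_invFun := ?_ }, hs, fun _ => rfl, fun z g hg => ?_⟩
  · rintro ⟨⟨u, g⟩, hg⟩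
    have hg' : Z.src (σ u) = G.r g := hg
    have h0 : Z.rng (Z.ract (σ u) g hg') = u := by rw [Z.rng_ract, hσ]
    have h1 : (⟨Z.rng (Z.ract (σ u) g hg'), h0 ▸ u.2⟩ : U) = u := Subtype.ext h0
    refine Subtype.ext (Prod.ext h1 ?_)
    refine hd2 _ g ((congrArg (fun u => Z.src (σ u)) h1).trans hg') ?_
    exact Z.ract_congr (congrArg σ h1) rfl _ _
  · have := Z.continuous_rng
    fun_prop
  · exact (Z.continuous_ract.comp (f := fun p : {p : U × G.Arr // Z.src (σ p.1) = G.r p.2} =>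
      (⟨(σ p.1.1, p.1.2), p.2⟩ : {p : Z.Z × G.Arr // Z.src p.1 = G.r p.2})) (by fun_prop)).subtype_mk _
  · have h0 : Z.rng (Z.ract z.1 g hg) ∈ U := by rw [Z.rng_ract]; exact z.2
    have h1 : (⟨Z.rng (Z.ract z.1 g hg), h0⟩ : U) = ⟨_, z.2⟩ := Subtype.ext (Z.rng_ract _ _ _)
    have h2 := e ⟨(σ ⟨_, z.2⟩, z.1), hz z⟩
    refine hd2 _ _ (((congrArg (fun u => Z.src (σ u)) h1).trans h2).trans (G.r_mul _ _ _).symm) ?_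
    refine (Z.ract_congr (congrArg σ h1) rfl _ (h2.trans (G.r_mul _ _ _).symm)).trans ?_
    rw [Z.ract_mul _ _ _ h2]
    exact Z.ract_congr (he ⟨(σ ⟨_, z.2⟩, z.1), hz z⟩) rfl _ _

end RealBibundle

namespace RealBibundle

open RealGroupoid (ofGroup)

variable {G : RealGroupoid.{u}} {S : Type u}

section Group

variable [Group S] [TopologicalSpace S] [RealGroup S]

/-- The right action of a Real group on a bundle whose structure groupoid is that group. -/
def act (Z : RealBibundle G (ofGroup S)) (z : Z.Z) (t : S) : Z.Z :=
  Z.ract z t rfl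

variable (Z : RealBibundle G (ofGroup S))

theorem act_one (z : Z.Z) : Z.act z 1 = z := Z.ract_unit z

theorem act_act (z : Z.Z) (t t' : S) : Z.act (Z.act z t) t' = Z.act z (t * t') :=
  (Z.ract_mul z t t' rfl rfl).symm

theorem rng_act (z : Z.Z) (t : S) : Z.rng (Z.act z t) = Z.rng z := Z.rng_ract z t rfl

theorem τ_act (z : Z.Z) (t : S) : Z.τ (Z.act z t) = Z.act (Z.τ z) (RealGroup.conj t) :=
  Z.τ_ract z t rfl

theorem lact_act (γ : G.Arr) (z : Z.Z) (t : S) (e : G.s γ = Z.rng (Z.act z t))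
    (e' : G.s γ = Z.rng z) : Z.lact γ (Z.act z t) e = Z.act (Z.lact γ z e') t :=
  Z.lact_ract γ z t e' rfl

theorem continuous_act : Continuous fun p : Z.Z × S => Z.act p.1 p.2 :=
  Z.continuous_ract.comp (f := fun p : Z.Z × S =>
    (⟨p, rfl⟩ : {p : Z.Z × (ofGroup S).Arr // Z.src p.1 = (ofGroup S).r p.2}))
    (continuous_id.subtype_mk _)

theorem IsPrincipal.exists_divS {Z : RealBibundle G (ofGroup S)} (hZ : Z.IsPrincipal) :
    ∃ d : {q : Z.Z × Z.Z // Z.rng q.1 = Z.rng q.2} → S, Continuous d ∧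
      (∀ q, Z.act q.1.1 (d q) = q.1.2) ∧ ∀ q t, Z.act q.1.1 t = q.1.2 → d q = t := by
  obtain ⟨d, h1, h2, h3⟩ := hZ.exists_div
  exact ⟨d, h1, fun q => (h2 q).choose_spec, fun q t h => h3 q t rfl h⟩

/-- A bundle with a continuous division map is principal as soon as it is locally split. -/
theorem isPrincipal_of_div
    (hs : ∀ y : G.Obj, ∃ U : Set G.Obj, IsOpen U ∧ y ∈ U ∧
      ∃ σ : C(U, Z.Z), ∀ u, Z.rng (σ u) = u)
    (d : {q : Z.Z × Z.Z // Z.rng q.1 = Z.rng q.2} → S) (hd : Continuous d)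
    (h1 : ∀ q, Z.act q.1.1 (d q) = q.1.2) (h2 : ∀ q t, Z.act q.1.1 t = q.1.2 → d q = t) :
    Z.IsPrincipal := by
  refine ⟨hs, isHomeomorph_iff_exists_homeomorph.2 ⟨
    { toFun := Z.shear
      invFun := fun q => ⟨(q.1.1, d q), rfl⟩
      left_inv := fun p => Subtype.ext (Prod.ext rfl (h2 _ _ rfl))
      right_inv := fun q => Subtype.ext (Prod.ext rfl (h1 q))
      continuous_toFun := ?_
      continuous_invFun := ?_ }, rfl⟩⟩
  · exact ((continuous_fst.comp continuous_subtype_val).prodMk Z.continuous_ract).subtype_mk _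
  · exact ((continuous_fst.comp continuous_subtype_val).prodMk hd).subtype_mk _

end Group

section CommGroup

variable [CommGroup S] [TopologicalSpace S] [RealGroup S]

/-- The fibred product `Z ×_X Z'`. -/
abbrev FibProd (Z Z' : RealBibundle G (ofGroup S)) : Type u :=
  {p : Z.Z × Z'.Z // Z.rng p.1 = Z'.rng p.2}

/-- The relation `(z, z') ∼ (z t⁻¹, z' t)` on `Z ×_X Z'`. -/
def sumSetoid (Z Z' : RealBibundle G (ofGroup S)) : Setoid (FibProd Z Z') where
  r p q := ∃ t : S, q.1.1 = Z.act p.1.1 t⁻¹ ∧ q.1.2 = Z'.act p.1.2 t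
  iseqv :=
    { refl := fun p => ⟨1, by rw [inv_one, act_one], by rw [act_one]⟩
      symm := fun {p q} ⟨t, h1, h2⟩ => ⟨t⁻¹, by rw [h1, act_act]; simp [act_one],
        by rw [h2, act_act]; simp [act_one]⟩
      trans := fun {p q w} ⟨t, h1, h2⟩ ⟨t', h3, h4⟩ => ⟨t * t',
        by rw [h3, h1, act_act, mul_inv], by rw [h4, h2, act_act]⟩ }

/-- The quotient space `Z ×_X Z' / ∼`. -/
abbrev SumSpace (Z Z' : RealBibundle G (ofGroup S)) : Type u :=
  Quotient (sumSetoid Z Z')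

variable (Z Z' : RealBibundle G (ofGroup S))

/-- The class `[z, z']`. -/
def sumMk (p : FibProd Z Z') : SumSpace Z Z' := Quotient.mk _ p

variable {Z Z'}

theorem sumMk_eq {p q : FibProd Z Z'} (t : S) (h1 : q.1.1 = Z.act p.1.1 t⁻¹)
    (h2 : q.1.2 = Z'.act p.1.2 t) : sumMk Z Z' p = sumMk Z Z' q :=
  Quotient.sound ⟨t, h1, h2⟩

theorem sumMk_eq_iff {p q : FibProd Z Z'} : sumMk Z Z' p = sumMk Z Z' q ↔
    ∃ t : S, q.1.1 = Z.act p.1.1 t⁻¹ ∧ q.1.2 = Z'.act p.1.2 t :=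
  Quotient.eq

theorem sumMk_ind {C : SumSpace Z Z' → Prop} (h : ∀ p, C (sumMk Z Z' p)) (q) : C q :=
  Quotient.ind h q

variable (Z Z')

theorem isOpenQuotientMap_sumMk : IsOpenQuotientMap (sumMk Z Z') := by
  refine ⟨Quotient.mk_surjective, continuous_quotient_mk', fun O hO => ?_⟩
  rw [isOpen_coinduced]
  let T : S → FibProd Z Z' → FibProd Z Z' := fun t p =>
    ⟨(Z.act p.1.1 t⁻¹, Z'.act p.1.2 t), by rw [rng_act, rng_act]; exact p.2⟩
  have hT : ∀ t, Continuous (T t) := fun t => by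
    have h1 := Z.continuous_act
    have h2 := Z'.continuous_act
    refine Continuous.subtype_mk (Continuous.prodMk ?_ ?_) _
    · exact h1.comp (f := fun p : FibProd Z Z' => (p.1.1, t⁻¹)) (by fun_prop)
    · exact h2.comp (f := fun p : FibProd Z Z' => (p.1.2, t)) (by fun_prop)
  have : Quotient.mk (sumSetoid Z Z') ⁻¹' (sumMk Z Z' '' O) = ⋃ t, T t ⁻¹' O := by
    ext p
    simp only [mem_preimage, mem_image, mem_iUnion]
    constructor
    · rintro ⟨q, hq, hqp⟩
      obtain ⟨t, h1, h2⟩ := sumMk_eq_iff.1 hqp.symm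
      refine ⟨t, ?_⟩
      rwa [show T t p = q from Subtype.ext (Prod.ext h1.symm h2.symm)]
    · rintro ⟨t, ht⟩
      exact ⟨_, ht, (sumMk_eq t rfl rfl).symm⟩
  exact this ▸ isOpen_iUnion fun t => hO.preimage (hT t)

/-- The projection of `Z ×_X Z' / ∼` to `X`. -/
def sumRng : SumSpace Z Z' → G.Obj :=
  Quotient.lift (fun p => Z.rng p.1.1) fun p q ⟨t, h1, _⟩ => by
    show Z.rng p.1.1 = Z.rng q.1.1
    rw [h1, rng_act]

/-- The Real structure `[z, z'] ↦ [τ z, τ' z']`. -/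
def sumτ : SumSpace Z Z' → SumSpace Z Z' :=
  Quotient.lift (fun p => sumMk Z Z' ⟨(Z.τ p.1.1, Z'.τ p.1.2), by
      rw [Z.rng_τ, Z'.rng_τ, p.2]⟩)
    fun p q ⟨t, h1, h2⟩ => sumMk_eq (RealGroup.conj t)
      (by show Z.τ q.1.1 = _; rw [h1, τ_act, map_inv]) (by show Z'.τ q.1.2 = _; rw [h2, τ_act])

/-- The right action `[z, z'] t = [z, z' t]`. -/
def sumAct (t : S) : SumSpace Z Z' → SumSpace Z Z' :=
  Quotient.lift (fun p => sumMk Z Z' ⟨(p.1.1, Z'.act p.1.2 t), by rw [rng_act]; exact p.2⟩)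
    fun p q ⟨t', h1, h2⟩ => sumMk_eq t' h1 (by
      show Z'.act q.1.2 t = Z'.act (Z'.act p.1.2 t) t'
      rw [h2, act_act, act_act, mul_comm])

theorem sumRng_sumAct (t : S) (q : SumSpace Z Z') :
    sumRng Z Z' (sumAct Z Z' t q) = sumRng Z Z' q := by
  induction q using sumMk_ind with | _ p
  rfl

/-- The left action `γ [z, z'] = [γ z, γ z']`. -/
def sumLact (γ : G.Arr) (q : SumSpace Z Z') : G.s γ = sumRng Z Z' q → SumSpace Z Z' :=
  Quotient.hrecOn (motive := fun q => G.s γ = sumRng Z Z' q → SumSpace Z Z') q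
    (fun p e => sumMk Z Z' ⟨(Z.lact γ p.1.1 e, Z'.lact γ p.1.2 (Eq.trans e p.2)),
      (Z.rng_lact _ _ _).trans (Z'.rng_lact _ _ _).symm⟩)
    fun p q h => by
      have hpq : sumRng Z Z' (Quotient.mk _ p) = sumRng Z Z' (Quotient.mk _ q) :=
        congrArg _ (Quotient.sound h)
      obtain ⟨t, h1, h2⟩ := h
      refine Function.hfunext (by rw [hpq]) fun e e' _ => heq_of_eq (sumMk_eq t ?_ ?_)
      · have e1 : G.s γ = Z.rng q.1.1 := e'
        show Z.lact γ q.1.1 e1 = _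
        generalize q.1.1 = z at h1 e1
        subst h1
        exact lact_act _ _ _ _ _ _
      · have e1 : G.s γ = Z'.rng q.1.2 := e'.trans q.2
        show Z'.lact γ q.1.2 e1 = _
        generalize q.1.2 = z at h2 e1
        subst h2
        exact lact_act _ _ _ _ _ _

variable {Z Z'} in
theorem sum_exists_div (hZ : Z.IsPrincipal) (hZ' : Z'.IsPrincipal) :
    ∃ d : {q : SumSpace Z Z' × SumSpace Z Z' // sumRng Z Z' q.1 = sumRng Z Z' q.2} → S,
      Continuous d ∧ (∀ q, sumAct Z Z' (d q) q.1.1 = q.1.2) ∧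
      ∀ q t, sumAct Z Z' t q.1.1 = q.1.2 → d q = t := by
  obtain ⟨d, hd, hd1, hd2⟩ := hZ.exists_divS
  obtain ⟨d', hd', hd1', hd2'⟩ := hZ'.exists_divS
  have hq := (isOpenQuotientMap_sumMk Z Z').prodMap (isOpenQuotientMap_sumMk Z Z')
  have hq' := hq.restrictPreimage {q | sumRng Z Z' q.1 = sumRng Z Z' q.2}
  let D : (Prod.map (sumMk Z Z') (sumMk Z Z') ⁻¹'
      {q | sumRng Z Z' q.1 = sumRng Z Z' q.2}) → S := fun p =>
    d ⟨(p.1.1.1.1, p.1.2.1.1), p.2⟩ *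
      d' ⟨(p.1.1.1.2, p.1.2.1.2), (p.1.1.2.symm.trans p.2).trans p.1.2.2⟩
  have hD : Continuous D := by
    refine Continuous.mul ?_ ?_
    · exact hd.comp (Continuous.subtype_mk (by fun_prop) _)
    · exact hd'.comp (Continuous.subtype_mk (by fun_prop) _)
  have hDS : ∀ p q (h : sumRng Z Z' (sumMk Z Z' p) = sumRng Z Z' (sumMk Z Z' q)) t,
      D ⟨(p, q), h⟩ = t ↔
      sumAct Z Z' t (sumMk Z Z' p) = sumMk Z Z' q := by
    intro p q h t
    have h : Z.rng p.1.1 = Z.rng q.1.1 := h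
    have h' : Z'.rng p.1.2 = Z'.rng q.1.2 := (p.2.symm.trans h).trans q.2
    have a1 : Z.act p.1.1 (d ⟨(p.1.1, q.1.1), h⟩) = q.1.1 := hd1 ⟨(p.1.1, q.1.1), h⟩
    have a2 : Z'.act p.1.2 (d' ⟨(p.1.2, q.1.2), h'⟩) = q.1.2 := hd1' ⟨(p.1.2, q.1.2), h'⟩
    show d ⟨(p.1.1, q.1.1), h⟩ * d' ⟨(p.1.2, q.1.2), h'⟩ = t ↔ _
    constructor
    · rintro rfl
      refine sumMk_eq (d ⟨(p.1.1, q.1.1), h⟩)⁻¹ ?_ ?_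
      · rw [inv_inv]; exact a1.symm
      · show _ = Z'.act (Z'.act p.1.2 _) _
        rw [act_act, mul_right_comm, mul_inv_cancel, one_mul]; exact a2.symm
    · intro hp
      obtain ⟨w, h1, h2⟩ := sumMk_eq_iff.1 hp
      rw [hd2 ⟨(p.1.1, q.1.1), h⟩ _ h1.symm,
        hd2' ⟨(p.1.2, q.1.2), h'⟩ (t * w) (by rw [← act_act]; exact h2.symm)]
      rw [mul_left_comm, inv_mul_cancel, mul_one]
  have hex : ∀ q : {q : SumSpace Z Z' × SumSpace Z Z' // sumRng Z Z' q.1 = sumRng Z Z' q.2},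
      ∃ t, sumAct Z Z' t q.1.1 = q.1.2 ∧ ∀ t', sumAct Z Z' t' q.1.1 = q.1.2 → t = t' := by
    rintro ⟨⟨x, y⟩, h⟩
    induction x using sumMk_ind with | _ p
    induction y using sumMk_ind with | _ q
    exact ⟨_, (hDS p q h _).1 rfl, fun t' h' => (hDS p q h _).2 h'⟩
  choose e he he' using hex
  refine ⟨e, ?_, he, he'⟩
  rw [hq'.isQuotientMap.continuous_iff]
  convert hD using 1
  funext ⟨⟨p, q⟩, h⟩
  exact he' _ _ ((hDS p q h _).1 rfl)

variable {Z Z'} in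
theorem sum_exists_section (hZ : Z.IsPrincipal) (hZ' : Z'.IsPrincipal) (y : G.Obj) :
    ∃ U : Set G.Obj, IsOpen U ∧ y ∈ U ∧
      ∃ σ : C(U, SumSpace Z Z'), ∀ u, sumRng Z Z' (σ u) = u := by
  obtain ⟨U, hU, hy, σ, hσ⟩ := hZ.1 y
  obtain ⟨V, hV, hy', σ', hσ'⟩ := hZ'.1 y
  refine ⟨U ∩ V, hU.inter hV, ⟨hy, hy'⟩, ⟨fun u => sumMk Z Z'
    ⟨(σ ⟨u, u.2.1⟩, σ' ⟨u, u.2.2⟩), by rw [hσ, hσ']⟩, ?_⟩, fun u => hσ ⟨u, u.2.1⟩⟩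
  exact (isOpenQuotientMap_sumMk Z Z').continuous.comp (Continuous.subtype_mk (by fun_prop) _)

theorem continuous_sumRng : Continuous (sumRng Z Z') :=
  (isOpenQuotientMap_sumMk Z Z').continuous_comp_iff.1
    (Z.continuous_rng.comp (by fun_prop : Continuous fun p : FibProd Z Z' => p.1.1))

theorem continuous_sumAct :
    Continuous fun p : SumSpace Z Z' × S => sumAct Z Z' p.2 p.1 := by
  rw [← ((isOpenQuotientMap_sumMk Z Z').prodMap (.id (X := S))).continuous_comp_iff]
  refine (isOpenQuotientMap_sumMk Z Z').continuous.comp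
    (f := fun p : FibProd Z Z' × S => (⟨(p.1.1.1, Z'.act p.1.1.2 p.2), _⟩ : FibProd Z Z')) ?_
  refine Continuous.subtype_mk (Continuous.prodMk (by fun_prop) ?_) _
  exact Z'.continuous_act.comp (by fun_prop : Continuous fun p : FibProd Z Z' × S => (p.1.1.2, p.2))

variable {Z Z'} in
theorem isOpenMap_sumRng (hZ : Z.IsPrincipal) (hZ' : Z'.IsPrincipal) :
    IsOpenMap (sumRng Z Z') := by
  intro O hO
  rw [isOpen_iff_mem_nhds]
  rintro _ ⟨q, hq, rfl⟩
  obtain ⟨U, hU, hy, σ, hσ⟩ := sum_exists_section hZ hZ' (sumRng Z Z' q)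
  obtain ⟨d, -, hd, -⟩ := sum_exists_div hZ hZ'
  have h0 : sumRng Z Z' (σ ⟨_, hy⟩) = sumRng Z Z' q := hσ _
  have ht := hd ⟨(σ ⟨_, hy⟩, q), h0⟩
  generalize d ⟨(σ ⟨_, hy⟩, q), h0⟩ = t at ht
  have hc : Continuous fun u : U => sumAct Z Z' t (σ u) :=
    (continuous_sumAct Z Z').comp (by fun_prop : Continuous fun u : U => (σ u, t))
  have hm : (fun u : U => sumAct Z Z' t (σ u)) ⁻¹' O ∈ 𝓝 (⟨_, hy⟩ : U) :=
    (hO.preimage hc).mem_nhds (by show sumAct Z Z' t _ ∈ O; rw [ht]; exact hq)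
  refine Filter.mem_of_superset (hU.isOpenMap_subtype_val.image_mem_nhds hm) ?_
  rintro _ ⟨u, hu, rfl⟩
  refine ⟨_, hu, ?_⟩
  exact (sumRng_sumAct Z Z' t _).trans (hσ u)

instance locallyCompactSpace_sumSpace : LocallyCompactSpace (SumSpace Z Z') := by
  have h1 : IsClosed {p : Z.Z × Z'.Z | Z.rng p.1 = Z'.rng p.2} :=
    isClosed_eq (Z.continuous_rng.comp continuous_fst) (Z'.continuous_rng.comp continuous_snd)
  have : LocallyCompactSpace (FibProd Z Z') := h1.isClosedEmbedding_subtypeVal.locallyCompactSpace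
  exact (isOpenQuotientMap_sumMk Z Z').locallyCompactSpace

variable {Z Z'} in
theorem t2Space_sumSpace (hZ : Z.IsPrincipal) (hZ' : Z'.IsPrincipal) :
    T2Space (SumSpace Z Z') := by
  obtain ⟨d, hd, hd1, hd2⟩ := sum_exists_div hZ hZ'
  have hc : IsClosed {q : SumSpace Z Z' × SumSpace Z Z' | sumRng Z Z' q.1 = sumRng Z Z' q.2} :=
    isClosed_eq ((continuous_sumRng Z Z').comp continuous_fst)
      ((continuous_sumRng Z Z').comp continuous_snd)
  have h2 := hc.isClosedEmbedding_subtypeVal.isClosedMap _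
    ((isClosed_singleton (x := (1 : S))).preimage hd)
  rw [t2_iff_isClosed_diagonal]
  convert h2
  have one : ∀ q, sumAct Z Z' 1 q = q := by
    intro q
    induction q using sumMk_ind with | _ p
    exact congrArg (sumMk Z Z') (Subtype.ext (Prod.ext rfl (act_one _ _)))
  ext ⟨x, y⟩
  simp only [mem_diagonal_iff, mem_image, mem_preimage, mem_singleton_iff, Subtype.exists,
    exists_and_right, exists_eq_right]
  constructor
  · rintro rfl
    exact ⟨rfl, hd2 _ _ (one x)⟩
  · rintro ⟨h, hxy⟩
    have := hd1 ⟨(x, y), h⟩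
    rw [hxy, one] at this
    exact this

theorem continuous_sumLact :
    Continuous fun p : {p : G.Arr × SumSpace Z Z' // G.s p.1 = sumRng Z Z' p.2} =>
      sumLact Z Z' p.1.1 p.1.2 p.2 := by
  have hq := ((IsOpenQuotientMap.id (X := G.Arr)).prodMap (isOpenQuotientMap_sumMk Z Z'))
  have hq' := hq.restrictPreimage {p : G.Arr × SumSpace Z Z' | G.s p.1 = sumRng Z Z' p.2}
  refine hq'.continuous_comp_iff.1 ?_
  have c1 := Z.continuous_lact
  have c2 := Z'.continuous_lact
  refine (isOpenQuotientMap_sumMk Z Z').continuous.comp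
    (f := fun p : (Prod.map id (sumMk Z Z') ⁻¹'
      {p : G.Arr × SumSpace Z Z' | G.s p.1 = sumRng Z Z' p.2}) =>
      (⟨(Z.lact p.1.1 p.1.2.1.1 p.2, Z'.lact p.1.1 p.1.2.1.2 (Eq.trans p.2 p.1.2.2)), _⟩ :
        FibProd Z Z')) ?_
  refine Continuous.subtype_mk (Continuous.prodMk ?_ ?_) _
  · refine c1.comp (f := fun p : (Prod.map id (sumMk Z Z') ⁻¹'
      {p : G.Arr × SumSpace Z Z' | G.s p.1 = sumRng Z Z' p.2}) =>
      (⟨(p.1.1, p.1.2.1.1), p.2⟩ : {p : G.Arr × Z.Z // G.s p.1 = Z.rng p.2})) ?_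
    exact Continuous.subtype_mk (by fun_prop) _
  · refine c2.comp (f := fun p : (Prod.map id (sumMk Z Z') ⁻¹'
      {p : G.Arr × SumSpace Z Z' | G.s p.1 = sumRng Z Z' p.2}) =>
      (⟨(p.1.1, p.1.2.1.2), Eq.trans p.2 p.1.2.2⟩ :
        {p : G.Arr × Z'.Z // G.s p.1 = Z'.rng p.2})) ?_
    exact Continuous.subtype_mk (by fun_prop) _

theorem continuous_sumτ : Continuous (sumτ Z Z') := by
  refine (isOpenQuotientMap_sumMk Z Z').continuous_comp_iff.1 ?_
  have c1 := Z.continuous_τ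
  have c2 := Z'.continuous_τ
  exact (isOpenQuotientMap_sumMk Z Z').continuous.comp
    (Continuous.subtype_mk (f := fun p : FibProd Z Z' => (Z.τ p.1.1, Z'.τ p.1.2)) (by fun_prop) _)

end CommGroup

end RealBibundle

namespace RealGenHom

open RealBibundle
open RealGroupoid (ofGroup)

variable {G : RealGroupoid.{u}} {S : Type u} [CommGroup S] [TopologicalSpace S] [RealGroup S]

/-- The underlying bibundle of the sum `Z ×_X Z' / ∼`. -/
def sumBibundle (Z Z' : RealGenHom G (ofGroup S)) : RealBibundle G (ofGroup S) where
  Z := SumSpace Z.toRealBibundle Z'.toRealBibundle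
  t2Z := t2Space_sumSpace Z.isPrincipal Z'.isPrincipal
  τ := sumτ _ _
  continuous_τ := continuous_sumτ _ _
  τ_τ := sumMk_ind fun p => congrArg (sumMk _ _)
    (Subtype.ext (Prod.ext (Z.τ_τ _) (Z'.τ_τ _)))
  rng := sumRng _ _
  src _ := PUnit.unit
  continuous_rng := continuous_sumRng _ _
  isOpenMap_rng := isOpenMap_sumRng Z.isPrincipal Z'.isPrincipal
  surjective_rng y := by
    obtain ⟨U, -, hy, σ, hσ⟩ := sum_exists_section Z.isPrincipal Z'.isPrincipal y
    exact ⟨σ ⟨y, hy⟩, hσ _⟩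
  continuous_src := continuous_const
  isOpenMap_src := fun O _ => isOpen_discrete (α := PUnit) _
  rng_τ := sumMk_ind fun p => Z.rng_τ _
  src_τ _ := rfl
  lact := sumLact _ _
  ract q t _ := sumAct _ _ t q
  continuous_lact := continuous_sumLact _ _
  continuous_ract := (continuous_sumAct _ _).comp continuous_subtype_val
  rng_lact γ := sumMk_ind fun p e => Z.rng_lact γ p.1.1 e
  src_lact _ _ _ := rfl
  src_ract _ _ _ := rfl
  rng_ract q t _ := sumRng_sumAct (S := S) _ _ t q
  unit_lact := sumMk_ind fun p => congrArg (sumMk _ _) (Subtype.ext (Prod.ext (Z.unit_lact _)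
    (by
      have := Z'.unit_lact p.1.2
      simp only [← p.2] at this
      exact this)))
  ract_unit := sumMk_ind fun p => congrArg (sumMk _ _) (Subtype.ext (Prod.ext rfl
    (act_one _ _)))
  mul_lact γ γ' := sumMk_ind fun p e e' => congrArg (sumMk _ _) (Subtype.ext (Prod.ext
    (Z.mul_lact _ _ _ e e') (Z'.mul_lact _ _ _ e _)))
  ract_mul q t t' _ _ := by
    induction q using sumMk_ind with | _ p
    exact congrArg (sumMk _ _) (Subtype.ext (Prod.ext rfl (act_act _ _ _ _).symm))
  lact_ract γ := sumMk_ind fun p t e _ => congrArg (sumMk _ _) (Subtype.ext (Prod.ext rfl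
    (lact_act _ _ _ _ _ _)))
  τ_lact γ := sumMk_ind fun p e => congrArg (sumMk _ _) (Subtype.ext (Prod.ext
    (Z.τ_lact _ _ _) (Z'.τ_lact _ _ _)))
  τ_ract := sumMk_ind fun p t _ => congrArg (sumMk _ _) (Subtype.ext (Prod.ext rfl
    (τ_act _ _ _)))

/-- The sum `(Z, τ) + (Z', τ') = (Z ×_X Z' / ∼, τ × τ')`. -/
def sum (Z Z' : RealGenHom G (ofGroup S)) : RealGenHom G (ofGroup S) :=
  have h : (sumBibundle Z Z').IsPrincipal := by
    obtain ⟨d, h1, h2, h3⟩ := sum_exists_div Z.isPrincipal Z'.isPrincipal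
    exact isPrincipal_of_div _ (sum_exists_section Z.isPrincipal Z'.isPrincipal) d h1 h2 h3
  { toRealBibundle := sumBibundle Z Z'
    isPrincipal := h
    isLocallyTrivial := h.isLocallyTrivial }

/-- The underlying bibundle of the inverse: `Z` with the right action `z • t = z t⁻¹`. -/
def invBibundle (Z : RealGenHom G (ofGroup S)) : RealBibundle G (ofGroup S) where
  __ := Z.toRealBibundle
  ract z t _ := Z.act z t⁻¹
  continuous_ract := Z.continuous_act.comp
    (f := fun p : {p : Z.Z × S // Z.src p.1 = PUnit.unit} => (p.1.1, p.1.2⁻¹)) (by fun_prop)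
  src_ract _ _ _ := rfl
  rng_ract z t _ := Z.rng_act z (t : S)⁻¹
  ract_unit z := (congrArg (Z.act z) inv_one).trans (Z.act_one z)
  ract_mul z t t' _ _ := (congrArg (Z.act z) (_root_.mul_inv (α := S) t t')).trans
    (Z.act_act z (t : S)⁻¹ (t' : S)⁻¹).symm
  lact_ract γ z t e _ := Z.lact_act γ z (t : S)⁻¹ _ e
  τ_ract := fun z (t : S) _ => (Z.τ_act z t⁻¹).trans
    (congrArg (Z.act (Z.τ z)) (map_inv (RealGroup.conj (S := S)) t))

/-- The inverse `(Z⁻¹, τ)`. -/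
def inv (Z : RealGenHom G (ofGroup S)) : RealGenHom G (ofGroup S) :=
  have h : (invBibundle Z).IsPrincipal := by
    obtain ⟨d, h1, h2, h3⟩ := Z.isPrincipal.exists_divS
    refine isPrincipal_of_div _ Z.isPrincipal.1 (fun q => (d q)⁻¹) h1.inv (fun q => ?_)
      (fun q t h => ?_)
    · exact (congrArg (Z.act _) (inv_inv _)).trans (h2 q)
    · exact (congrArg _ (h3 q t⁻¹ h)).trans (inv_inv t)
  { toRealBibundle := invBibundle Z
    isPrincipal := h
    isLocallyTrivial := h.isLocallyTrivial }

end RealGenHom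

namespace RealGroupoid

/-- The space `G_n` of strict morphisms from the pair groupoid `[n] × [n] ⇉ [n]` to `G`. -/
@[ext]
structure Nerve (G : RealGroupoid.{u}) (n : ℕ) where
  obj : Fin (n + 1) → G.Obj
  arr : Fin (n + 1) → Fin (n + 1) → G.Arr
  r_arr : ∀ i j, G.r (arr i j) = obj i
  s_arr : ∀ i j, G.s (arr i j) = obj j
  arr_self : ∀ i, arr i i = G.unit (obj i)
  arr_mul : ∀ i j k, G.mul (arr i j) (arr j k) ((s_arr i j).trans (r_arr j k).symm) = arr i k

namespace Nerve

variable {G : RealGroupoid.{u}} {m n : ℕ}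

instance : TopologicalSpace (Nerve G n) :=
  TopologicalSpace.induced (fun x => (x.obj, x.arr)) inferInstance

theorem continuous_pair : Continuous fun x : Nerve G n => (x.obj, x.arr) :=
  continuous_induced_dom

/-- The Real structure `ρ_n`. -/
def ρ (x : Nerve G n) : Nerve G n where
  obj i := G.ρ₀ (x.obj i)
  arr i j := G.ρ (x.arr i j)
  r_arr i j := by rw [G.r_ρ, x.r_arr]
  s_arr i j := by rw [G.s_ρ, x.s_arr]
  arr_self i := by rw [x.arr_self, G.ρ_unit]
  arr_mul i j k := (G.ρ_mul _ _ ((x.s_arr i j).trans (x.r_arr j k).symm)).symm.trans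
    (congrArg G.ρ (x.arr_mul i j k))

/-- The map `G_n → G_m` induced by a map `[m] → [n]`. -/
def face (f : Fin (m + 1) → Fin (n + 1)) (x : Nerve G n) : Nerve G m where
  obj i := x.obj (f i)
  arr i j := x.arr (f i) (f j)
  r_arr _ _ := x.r_arr _ _
  s_arr _ _ := x.s_arr _ _
  arr_self _ := x.arr_self _
  arr_mul _ _ _ := x.arr_mul _ _ _

theorem ρ_ρ (x : Nerve G n) : ρ (ρ x) = x :=
  Nerve.ext (funext fun _ => G.ρ₀_ρ₀ _) (funext fun _ => funext fun _ => G.ρ_ρ _)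

theorem face_ρ (f : Fin (m + 1) → Fin (n + 1)) (x : Nerve G n) : face f (ρ x) = ρ (face f x) := rfl

theorem continuous_face (f : Fin (m + 1) → Fin (n + 1)) : Continuous (face (G := G) f) := by
  have h := continuous_pair (G := G) (n := n)
  have h1 := continuous_fst.comp h
  have h2 := continuous_snd.comp h
  refine continuous_induced_rng.2 (Continuous.prodMk ?_ ?_)
  · exact continuous_pi fun i => (continuous_apply (f i)).comp h1
  · exact continuous_pi fun i => continuous_pi fun j =>
      (continuous_apply (f j)).comp ((continuous_apply (f i)).comp h2)

end Nerve

end RealGroupoid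

open RealGroupoid (Nerve)

/-- A Real open cover of `(X, ρ)`: an open cover indexed by a set with an involution
`j ↦ j̄` such that `U_j̄ = ρ(U_j)`. -/
structure RealCover (X : Type u) [TopologicalSpace X] (ρ : X → X) where
  J : Type u
  bar : J → J
  bar_bar : ∀ j, bar (bar j) = j
  U : J → Set X
  isOpen_U : ∀ j, IsOpen (U j)
  exists_mem : ∀ x, ∃ j, x ∈ U j
  U_bar : ∀ j, U (bar j) = ρ '' U j

theorem RealCover.mem_bar {X : Type u} [TopologicalSpace X] {ρ : X → X} (V : RealCover X ρ) {j : V.J}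
    {x : X} (hx : x ∈ V.U j) : ρ x ∈ V.U (V.bar j) := by
  rw [V.U_bar]; exact mem_image_of_mem _ hx

/-- A Real open cover of `G_•`: a sequence of Real open covers of the spaces `G_n`. -/
abbrev NerveCover (G : RealGroupoid.{u}) : Type (u + 1) :=
  ∀ n : ℕ, RealCover (Nerve G n) Nerve.ρ

/-- A pre-simplicial Real open cover of `G_•`: strictly increasing maps `f : [m] → [n]` act on the
index sets, compatibly with the involutions, and `f̃(U^n_j) ⊆ U^m_{f̃(j)}`. -/
structure PreSimplicialCover (G : RealGroupoid.{u}) where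
  cov : NerveCover G
  face : ∀ {m n : ℕ}, (Fin (m + 1) ↪o Fin (n + 1)) → (cov n).J → (cov m).J
  face_id : ∀ {n : ℕ} (j : (cov n).J), face (RelEmbedding.refl _) j = j
  face_comp : ∀ {l m n : ℕ} (f : Fin (l + 1) ↪o Fin (m + 1)) (g : Fin (m + 1) ↪o Fin (n + 1))
    (j : (cov n).J), face (f.trans g) j = face f (face g j)
  face_bar : ∀ {m n : ℕ} (f : Fin (m + 1) ↪o Fin (n + 1)) (j : (cov n).J),
    face f ((cov n).bar j) = (cov m).bar (face f j)
  face_mem : ∀ {m n : ℕ} (f : Fin (m + 1) ↪o Fin (n + 1)) (j : (cov n).J), ∀ x ∈ (cov n).U j,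
    Nerve.face f x ∈ (cov m).U (face f j)

namespace PreSimplicialCover

variable {G : RealGroupoid.{u}} (V : PreSimplicialCover G) {S : Type u}

section Group

variable [Group S] [TopologicalSpace S] [RealGroup S]

/-- The group of Real `n`-cochains: families of continuous maps `c_j : U^n_j → S` such that
`c_j̄(ρ_n(x))` is the conjugate of `c_j(x)`. -/
def CR (S : Type u) [Group S] [TopologicalSpace S] [RealGroup S] (n : ℕ) :
    Subgroup (∀ j : (V.cov n).J, C((V.cov n).U j, S)) where
  carrier := {c | ∀ j x (hx : x ∈ (V.cov n).U j),
    c ((V.cov n).bar j) ⟨Nerve.ρ x, (V.cov n).mem_bar hx⟩ = RealGroup.conj (c j ⟨x, hx⟩)}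
  mul_mem' := fun {a b} ha hb j x hx => by simp [ha j x hx, hb j x hx]
  one_mem' := fun j x hx => by simp
  inv_mem' := fun {a} ha j x hx => by simp [ha j x hx]

/-- The restriction map `f̃^* : Γ(U^m_{f̃(j)}, S) → Γ(U^n_j, S)`, applied to a member of a
family `c`. -/
def res {m n : ℕ} (c : ∀ j : (V.cov m).J, C((V.cov m).U j, S)) (f : Fin (m + 1) ↪o Fin (n + 1))
    (j : (V.cov n).J) : C((V.cov n).U j, S) :=
  (c (V.face f j)).comp ⟨fun x => ⟨Nerve.face f x.1, V.face_mem f j x.1 x.2⟩,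
    ((Nerve.continuous_face f).comp continuous_subtype_val).subtype_mk _⟩

/-- The map `ε_k : [n] → [n + 1]` that avoids `k`. -/
abbrev ε {n : ℕ} (k : Fin (n + 2)) : Fin (n + 1) ↪o Fin (n + 2) :=
  Fin.succAboveOrderEmb k

/-- Real `1`-cocycles: `ε₁^* c = ε₂^* c · ε₀^* c`, that is
`c_{j₀j₂}(g₁g₂) = c_{j₀j₁}(g₁) c_{j₁j₂}(g₂)`. -/
def ZR1 (S : Type u) [Group S] [TopologicalSpace S] [RealGroup S] : Type u :=
  {c : V.CR S 1 // ∀ j : (V.cov 2).J, V.res c.1 (ε 1) j = V.res c.1 (ε 2) j * V.res c.1 (ε 0) j}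

/-- Two `1`-cocycles are cohomologous if `c' = (ε₁^* φ)⁻¹ · c · ε₀^* φ` for a Real
`0`-cochain `φ`. -/
instance cohSetoid (S : Type u) [Group S] [TopologicalSpace S] [RealGroup S] :
    Setoid (V.ZR1 S) where
  r c c' := ∃ φ : V.CR S 0, ∀ j : (V.cov 1).J,
    c'.1.1 j = (V.res φ.1 (ε 1) j)⁻¹ * c.1.1 j * V.res φ.1 (ε 0) j
  iseqv :=
    { refl := fun c => ⟨1, fun j => by ext x; simp [res]⟩
      symm := fun {c c'} ⟨φ, h⟩ => ⟨φ⁻¹, fun j => by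
        ext x; simp [res, h]; group⟩
      trans := fun {c c' c''} ⟨φ, h⟩ ⟨ψ, h'⟩ => ⟨φ * ψ, fun j => by
        ext x; simp [res, h, h']; group⟩ }

/-- The first Real cohomology of a pre-simplicial Real open cover. -/
def HR1ss (S : Type u) [Group S] [TopologicalSpace S] [RealGroup S] : Type u :=
  Quotient (V.cohSetoid S)

end Group

section CommGroup

variable [CommGroup S] [TopologicalSpace S] [RealGroup S]

/-- The differential `(dc)_j = ∏_k (ε_k^* c_{ε_k(j)})^{(-1)^k}`. -/
def d (n : ℕ) (c : V.CR S n) (j : (V.cov (n + 1)).J) : C((V.cov (n + 1)).U j, S) :=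
  ∏ k : Fin (n + 2), V.res c.1 (ε k) j ^ ((-1 : ℤ) ^ (k : ℕ))

/-- For commutative `S`, a Real `1`-cochain is a cocycle if and only if `dc = 1`. -/
theorem cocycle_iff (c : V.CR S 1) :
    (∀ j : (V.cov 2).J, V.res c.1 (ε 1) j = V.res c.1 (ε 2) j * V.res c.1 (ε 0) j) ↔
      ∀ j, V.d 1 c j = 1 := by
  refine forall_congr' fun j => ?_
  have h : V.d 1 c j = V.res c.1 (ε 0) j ^ ((-1 : ℤ) ^ 0) * V.res c.1 (ε 1) j ^ ((-1 : ℤ) ^ 1) *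
      V.res c.1 (ε 2) j ^ ((-1 : ℤ) ^ 2) :=
    Fin.prod_univ_three fun k : Fin 3 => V.res c.1 (ε k) j ^ ((-1 : ℤ) ^ (k : ℕ))
  rw [h]
  simp only [pow_zero, pow_one, even_two, Even.neg_pow, one_pow, zpow_one, zpow_neg]
  rw [mul_right_comm, mul_inv_eq_one, mul_comm (V.res c.1 (ε 0) j), eq_comm]

/-- For commutative `S`, cohomologous cocycles are those that differ by a coboundary. -/
theorem cohomologous_iff (c c' : V.ZR1 S) :
    c ≈ c' ↔ ∃ φ : V.CR S 0, ∀ j, c'.1.1 j = c.1.1 j * V.d 0 φ j := by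
  refine exists_congr fun φ => forall_congr' fun j => ?_
  have h : V.d 0 φ j = V.res φ.1 (ε 0) j ^ ((-1 : ℤ) ^ 0) * V.res φ.1 (ε 1) j ^ ((-1 : ℤ) ^ 1) :=
    Fin.prod_univ_two fun k : Fin 2 => V.res φ.1 (ε k) j ^ ((-1 : ℤ) ^ (k : ℕ))
  rw [h]
  simp only [pow_zero, pow_one, zpow_one, zpow_neg]
  rw [mul_assoc, mul_comm, mul_assoc]

/-- Real `1`-cocycles form a subgroup of the group of cochains. -/
def ZR1Subgroup (S : Type u) [CommGroup S] [TopologicalSpace S] [RealGroup S] :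
    Subgroup (V.CR S 1) where
  carrier := {c | ∀ j : (V.cov 2).J, V.res c.1 (ε 1) j = V.res c.1 (ε 2) j * V.res c.1 (ε 0) j}
  mul_mem' := fun {a b} ha hb j => by
    have h1 := ha j
    have h2 := hb j
    ext x
    have h1 := congrArg (fun c => c x) h1
    have h2 := congrArg (fun c => c x) h2
    simp [res] at h1 h2 ⊢
    rw [h1, h2, mul_mul_mul_comm]
  one_mem' := fun j => by ext x; simp [res]
  inv_mem' := fun {a} ha j => by
    ext x
    have h1 := congrArg (fun c => c x) (ha j)
    simp [res] at h1 ⊢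
    rw [h1, mul_inv]

instance : CommGroup (V.ZR1 S) :=
  inferInstanceAs (CommGroup (V.ZR1Subgroup S))

theorem mul_apply (a b : V.ZR1 S) (j : (V.cov 1).J) (x : (V.cov 1).U j) :
    (a * b).1.1 j x = a.1.1 j x * b.1.1 j x := rfl

/-- The congruence modulo coboundaries. -/
def cohCon (S : Type u) [CommGroup S] [TopologicalSpace S] [RealGroup S] : Con (V.ZR1 S) where
  toSetoid := V.cohSetoid S
  mul' := fun {a b a' b'} ⟨φ, h⟩ ⟨ψ, h'⟩ => ⟨φ * ψ, fun j => by
    ext x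
    have h1 := congrArg (fun c => c x) (h j)
    have h2 := congrArg (fun c => c x) (h' j)
    simp only [res, ContinuousMap.mul_apply, ContinuousMap.inv_apply, ContinuousMap.comp_apply,
      Subgroup.coe_mul, Pi.mul_apply, mul_apply] at h1 h2 ⊢
    rw [h1, h2, mul_inv, mul_mul_mul_comm, mul_mul_mul_comm (_⁻¹)]⟩

/-- For commutative `S`, the first Real cohomology of a cover is a group. -/
instance : CommGroup (V.HR1ss S) :=
  inferInstanceAs (CommGroup (V.cohCon S).Quotient)

end CommGroup

/-- A pre-simplicial refinement from `W` to `V`. -/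
structure Refinement (W V : PreSimplicialCover G) where
  θ : ∀ n, (W.cov n).J → (V.cov n).J
  θ_bar : ∀ n i, θ n ((W.cov n).bar i) = (V.cov n).bar (θ n i)
  subset : ∀ n i, (W.cov n).U i ⊆ (V.cov n).U (θ n i)
  θ_face : ∀ {m n : ℕ} (f : Fin (m + 1) ↪o Fin (n + 1)) (i : (W.cov n).J),
    θ m (W.face f i) = V.face f (θ n i)

namespace Refinement

variable {V} {W : PreSimplicialCover G} (θ : Refinement W V)

section Group

variable [Group S] [TopologicalSpace S] [RealGroup S]

/-- The restriction `(θ^* c)_i = c_{θ(i)}|_{W_i}` of cochains. -/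
def cochain (n : ℕ) (c : V.CR S n) : W.CR S n :=
  ⟨fun i => (c.1 (θ.θ n i)).comp (ContinuousMap.inclusion (θ.subset n i)), fun i x hx => by
    have := c.2 (θ.θ n i) x (θ.subset n i hx)
    rw [ContinuousMap.comp_apply, ContinuousMap.comp_apply]
    refine Eq.trans ?_ this
    have key : ∀ j j' (h : j = j') (y : Nerve G n) (hy : y ∈ (V.cov n).U j)
        (hy' : y ∈ (V.cov n).U j'), c.1 j ⟨y, hy⟩ = c.1 j' ⟨y, hy'⟩ := by
      rintro j _ rfl y hy hy'; rfl
    exact key _ _ (θ.θ_bar n i) _ _ _⟩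

theorem res_cochain {m n : ℕ} (c : V.CR S m) (f : Fin (m + 1) ↪o Fin (n + 1)) (i : (W.cov n).J) :
    W.res (θ.cochain m c).1 f i =
      (V.res c.1 f (θ.θ n i)).comp (ContinuousMap.inclusion (θ.subset n i)) := by
  ext x
  have key : ∀ j j' (h : j = j') (y : Nerve G m) (hy : y ∈ (V.cov m).U j)
      (hy' : y ∈ (V.cov m).U j'), c.1 j ⟨y, hy⟩ = c.1 j' ⟨y, hy'⟩ := by
    rintro j _ rfl y hy hy'; rfl
  exact key _ _ (θ.θ_face f i) _ _ _

/-- The restriction of cocycles. -/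
def cocycle (c : V.ZR1 S) : W.ZR1 S :=
  ⟨θ.cochain 1 c.1, fun i => by
    simp only [res_cochain, c.2 (θ.θ 2 i)]
    rfl⟩

/-- The map induced by a refinement in cohomology. -/
def map : V.HR1ss S → W.HR1ss S :=
  Quotient.map' θ.cocycle fun c c' ⟨φ, h⟩ => ⟨θ.cochain 0 φ, fun i => by
    simp only [res_cochain]
    show (c'.1.1 (θ.θ 1 i)).comp _ = _
    rw [h]
    rfl⟩

end Group

theorem map_mul [CommGroup S] [TopologicalSpace S] [RealGroup S] (x y : V.HR1ss S) :
    θ.map (x * y) = θ.map x * θ.map y := by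
  induction x using Quotient.inductionOn
  induction y using Quotient.inductionOn
  rfl

theorem map_one [CommGroup S] [TopologicalSpace S] [RealGroup S] :
    θ.map (1 : V.HR1ss S) = 1 := rfl

theorem map_inv [CommGroup S] [TopologicalSpace S] [RealGroup S] (x : V.HR1ss S) :
    θ.map x⁻¹ = (θ.map x)⁻¹ := by
  induction x using Quotient.inductionOn
  rfl

end Refinement

end PreSimplicialCover

namespace NerveCover

variable {G : RealGroupoid.{u}}

/-- The pre-simplicial Real open cover `♮U` associated to a Real open cover `U`: its index set
`Λ_n` consists of the families `λ = (λ_φ)` with `λ_φ ∈ J_k` for every strictly increasing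
`φ : [k] → [n]`, and `U^n_λ = ⋂_φ φ̃⁻¹(U^k_{λ_φ})`. -/
def nat (U : NerveCover G) : PreSimplicialCover G where
  cov n :=
    { J := ∀ k : ℕ, (Fin (k + 1) ↪o Fin (n + 1)) → (U k).J
      bar := fun l k φ => (U k).bar (l k φ)
      bar_bar := fun l => funext fun k => funext fun φ => (U k).bar_bar _
      U := fun l => {x | ∀ k φ, Nerve.face φ x ∈ (U k).U (l k φ)}
      isOpen_U := fun l => by
        have : {x : Nerve G n | ∀ k φ, Nerve.face φ x ∈ (U k).U (l k φ)} =
            ⋂ k ∈ Finset.range (n + 1), ⋂ φ : Fin (k + 1) ↪o Fin (n + 1),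
              Nerve.face φ ⁻¹' (U k).U (l k φ) := by
          ext x
          simp only [mem_ofPred_eq, mem_iInter, mem_preimage, Finset.mem_range]
          refine ⟨fun h k _ φ => h k φ, fun h k φ => h k ?_ φ⟩
          have := Fintype.card_le_of_injective φ φ.injective
          simpa using this
        rw [this]
        refine isOpen_biInter_finset fun k _ => isOpen_iInter_of_finite fun φ => ?_
        exact ((U k).isOpen_U _).preimage (Nerve.continuous_face φ)
      exists_mem := fun x => ⟨fun k φ => ((U k).exists_mem (Nerve.face φ x)).choose,
        fun k φ => ((U k).exists_mem (Nerve.face φ x)).choose_spec⟩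
      U_bar := fun l => by
        have key : ∀ (l : ∀ k : ℕ, (Fin (k + 1) ↪o Fin (n + 1)) → (U k).J) (x : Nerve G n),
            (∀ k φ, Nerve.face φ x ∈ (U k).U (l k φ)) →
              ∀ k φ, Nerve.face φ (Nerve.ρ x) ∈ (U k).U ((U k).bar (l k φ)) :=
          fun l x h k φ => (U k).mem_bar (h k φ)
        ext x
        constructor
        · intro h
          refine ⟨Nerve.ρ x, ?_, Nerve.ρ_ρ x⟩
          intro k φ
          have := key _ x h k φ
          rwa [(U k).bar_bar] at this
        · rintro ⟨y, hy, rfl⟩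
          exact key l y hy }
  face f l := fun k φ => l k (φ.trans f)
  face_id _ := rfl
  face_comp _ _ _ := rfl
  face_bar _ _ := rfl
  face_mem f _ _ hx := fun k φ => hx k (φ.trans f)

/-- The `N`-skeleton of `U` admits an `N`-simplicial Real structure: all increasing maps
`f : [m] → [n]` with `m, n ≤ N` act on the index sets, compatibly with the involutions, and
`f̃(U^n_j) ⊆ U^m_{f̃(j)}`. -/
def HasSimplicialStructure (U : NerveCover G) (N : ℕ) : Prop :=
  ∃ F : ∀ {m n : ℕ}, m ≤ N → n ≤ N → (Fin (m + 1) →o Fin (n + 1)) → (U n).J → (U m).J,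
    (∀ {n : ℕ} (hn : n ≤ N) (j : (U n).J), F hn hn OrderHom.id j = j) ∧
    (∀ {l m n : ℕ} (hl : l ≤ N) (hm : m ≤ N) (hn : n ≤ N) (f : Fin (l + 1) →o Fin (m + 1))
      (g : Fin (m + 1) →o Fin (n + 1)) (j : (U n).J),
      F hl hn (g.comp f) j = F hl hm f (F hm hn g j)) ∧
    (∀ {m n : ℕ} (hm : m ≤ N) (hn : n ≤ N) (f : Fin (m + 1) →o Fin (n + 1)) (j : (U n).J),
      F hm hn f ((U n).bar j) = (U m).bar (F hm hn f j)) ∧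
    ∀ {m n : ℕ} (hm : m ≤ N) (hn : n ≤ N) (f : Fin (m + 1) →o Fin (n + 1)) (j : (U n).J),
      ∀ x ∈ (U n).U j, Nerve.face f x ∈ (U m).U (F hm hn f j)

theorem HasSimplicialStructure.mono {U : NerveCover G} {M N : ℕ} (h : U.HasSimplicialStructure N)
    (hM : M ≤ N) : U.HasSimplicialStructure M := by
  obtain ⟨F, h1, h2, h3, h4⟩ := h
  exact ⟨fun hm hn => F (hm.trans hM) (hn.trans hM), fun _ _ => h1 _ _,
    fun _ _ _ _ _ _ => h2 _ _ _ _ _ _, fun _ _ _ _ => h3 _ _ _ _, fun _ _ _ _ => h4 _ _ _ _⟩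

/-- A refinement from `W` to `U`. -/
structure Refinement (W U : NerveCover G) where
  θ : ∀ n, (W n).J → (U n).J
  θ_bar : ∀ n i, θ n ((W n).bar i) = (U n).bar (θ n i)
  subset : ∀ n i, (W n).U i ⊆ (U n).U (θ n i)

/-- The refinement of the associated pre-simplicial covers. -/
def Refinement.nat {W U : NerveCover G} (θ : Refinement W U) :
    PreSimplicialCover.Refinement W.nat U.nat where
  θ _ l := fun k φ => θ.θ k (l k φ)
  θ_bar _ _ := funext fun k => funext fun _ => θ.θ_bar k _
  subset _ _ := fun _ hx k φ => θ.subset k _ (hx k φ)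
  θ_face _ _ := rfl

/-- Composition of refinements. -/
def Refinement.comp {W V U : NerveCover G} (θ : Refinement V U) (η : Refinement W V) :
    Refinement W U where
  θ n i := θ.θ n (η.θ n i)
  θ_bar n i := by rw [η.θ_bar, θ.θ_bar]
  subset n i := (η.subset n i).trans (θ.subset n _)

theorem Refinement.map_comp {S : Type u} [Group S] [TopologicalSpace S] [RealGroup S]
    {W V U : NerveCover G} (θ : Refinement V U) (η : Refinement W V) (x : U.nat.HR1ss S) :
    (θ.comp η).nat.map x = η.nat.map (θ.nat.map x) := by
  induction x using Quotient.inductionOn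
  rfl

/-- The cover by the sets `U_j ∩ V_{j'}`. -/
def prod (U V : NerveCover G) : NerveCover G := fun n =>
  { J := (U n).J × (V n).J
    bar := fun j => ((U n).bar j.1, (V n).bar j.2)
    bar_bar := fun j => Prod.ext ((U n).bar_bar _) ((V n).bar_bar _)
    U := fun j => (U n).U j.1 ∩ (V n).U j.2
    isOpen_U := fun j => ((U n).isOpen_U _).inter ((V n).isOpen_U _)
    exists_mem := fun x => by
      obtain ⟨j, hj⟩ := (U n).exists_mem x
      obtain ⟨k, hk⟩ := (V n).exists_mem x
      exact ⟨(j, k), hj, hk⟩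
    U_bar := fun j => by
      rw [image_inter (Function.LeftInverse.injective Nerve.ρ_ρ), (U n).U_bar, (V n).U_bar] }

/-- The cover with one member in each degree. -/
def trivial (G : RealGroupoid.{u}) : NerveCover G := fun _ =>
  { J := PUnit
    bar := id
    bar_bar := fun _ => rfl
    U := fun _ => univ
    isOpen_U := fun _ => isOpen_univ
    exists_mem := fun _ => ⟨PUnit.unit, Set.mem_univ _⟩
    U_bar := fun _ => (image_univ_of_surjective fun x => ⟨_, Nerve.ρ_ρ x⟩).symm }

theorem HasSimplicialStructure.prod {U V : NerveCover G} {N : ℕ}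
    (h : U.HasSimplicialStructure N) (h' : V.HasSimplicialStructure N) :
    (U.prod V).HasSimplicialStructure N := by
  obtain ⟨F, h1, h2, h3, h4⟩ := h
  obtain ⟨F', h1', h2', h3', h4'⟩ := h'
  exact ⟨fun hm hn f j => (F hm hn f j.1, F' hm hn f j.2),
    fun _ _ => Prod.ext (h1 _ _) (h1' _ _),
    fun _ _ _ _ _ _ => Prod.ext (h2 _ _ _ _ _ _) (h2' _ _ _ _ _ _),
    fun _ _ _ _ => Prod.ext (h3 _ _ _ _) (h3' _ _ _ _),
    fun _ _ _ _ x hx => ⟨h4 _ _ _ _ x hx.1, h4' _ _ _ _ x hx.2⟩⟩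

theorem HasSimplicialStructure.trivial (N : ℕ) :
    (NerveCover.trivial G).HasSimplicialStructure N :=
  ⟨fun _ _ _ j => j, fun _ _ => rfl, fun _ _ _ _ _ _ => rfl, fun _ _ _ _ => rfl,
    fun _ _ _ _ _ _ => Set.mem_univ _⟩

/-- The first projection of `U × V`. -/
def prodFst (U V : NerveCover G) : Refinement (U.prod V) U where
  θ _ j := j.1
  θ_bar _ _ := rfl
  subset _ _ _ hx := hx.1

/-- The second projection of `U × V`. -/
def prodSnd (U V : NerveCover G) : Refinement (U.prod V) V where
  θ _ j := j.2
  θ_bar _ _ := rfl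
  subset _ _ _ hx := hx.2

/-- A refinement of both `U` and `V` is a refinement of `U × V`. -/
def Refinement.pair {W U V : NerveCover G} (θ : Refinement W U) (η : Refinement W V) :
    Refinement W (U.prod V) where
  θ n i := (θ.θ n i, η.θ n i)
  θ_bar n i := Prod.ext (θ.θ_bar n i) (η.θ_bar n i)
  subset n i := subset_inter (θ.subset n i) (η.subset n i)

/-- Every cover refines the cover with one member. -/
def Refinement.toTrivial (W : NerveCover G) : Refinement W (trivial G) where
  θ _ _ := PUnit.unit
  θ_bar _ _ := rfl
  subset _ _ := subset_univ _

end NerveCover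

/-- The collection `𝔑(1)` of Real open covers of `G_•` whose `N`-skeleton admits an
`N`-simplicial Real structure for some `N ≥ 2`. -/
structure NerveCover.Adm (G : RealGroupoid.{u}) where
  cov : NerveCover G
  exists_simplicial : ∃ N, 2 ≤ N ∧ cov.HasSimplicialStructure N

namespace NerveCover.Adm

variable {G : RealGroupoid.{u}}

/-- The product in `𝔑(1)`. -/
abbrev prod (U V : Adm G) : Adm G where
  cov := U.cov.prod V.cov
  exists_simplicial := by
    obtain ⟨N, hN, h⟩ := U.exists_simplicial
    obtain ⟨N', hN', h'⟩ := V.exists_simplicial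
    exact ⟨min N N', le_min hN hN', (h.mono (min_le_left _ _)).prod (h'.mono (min_le_right _ _))⟩

/-- The trivial cover, in `𝔑(1)`. -/
abbrev trivial (G : RealGroupoid.{u}) : Adm G where
  cov := NerveCover.trivial G
  exists_simplicial := ⟨2, le_rfl, .trivial 2⟩

end NerveCover.Adm

/-- The relation generating the direct limit of the sets `HR¹(U, S) = HR¹_ss(♮U, S)`. -/
inductive CechRel (G : RealGroupoid.{u}) (S : Type u) [Group S] [TopologicalSpace S] [RealGroup S] :
    (Σ U : NerveCover.Adm G, U.cov.nat.HR1ss S) → (Σ U : NerveCover.Adm G, U.cov.nat.HR1ss S) → Prop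
  | of (U W : NerveCover.Adm G) (θ : NerveCover.Refinement W.cov U.cov) (x : U.cov.nat.HR1ss S) :
      CechRel G S ⟨U, x⟩ ⟨W, θ.nat.map x⟩

/-- The first Real Čech cohomology of `G_•` with coefficients in the Real group `S`: the direct
limit of `HR¹(U, S)` over the covers `U` in `𝔑(1)`. -/
def CechHR1 (G : RealGroupoid.{u}) (S : Type u) [Group S] [TopologicalSpace S] [RealGroup S] :
    Type (u + 1) :=
  Quot (CechRel G S)

namespace CechHR1

variable {G : RealGroupoid.{u}} {S : Type u}

section Group

variable [Group S] [TopologicalSpace S] [RealGroup S]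

/-- The class of a cohomology class of the cover `U`. -/
def of (U : NerveCover.Adm G) (x : U.cov.nat.HR1ss S) : CechHR1 G S :=
  Quot.mk _ ⟨U, x⟩

/-- The class of a cocycle over the cover `U`. -/
def mk (U : NerveCover.Adm G) (c : U.cov.nat.ZR1 S) : CechHR1 G S :=
  of U (Quotient.mk _ c)

theorem of_map {U W : NerveCover.Adm G} (θ : NerveCover.Refinement W.cov U.cov)
    (x : U.cov.nat.HR1ss S) : of W (θ.nat.map x) = of U x :=
  (Quot.sound (CechRel.of U W θ x)).symm

theorem ind {C : CechHR1 G S → Prop} (h : ∀ U x, C (of U x)) (a : CechHR1 G S) : C a :=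
  Quot.ind (fun p => h p.1 p.2) a

end Group

section CommGroup

variable [CommGroup S] [TopologicalSpace S] [RealGroup S]

/-- The sum of classes over two covers, over the cover by intersections. -/
def mulAux (U V : NerveCover.Adm G) (x : U.cov.nat.HR1ss S) (y : V.cov.nat.HR1ss S) : CechHR1 G S :=
  of (U.prod V) ((NerveCover.prodFst U.cov V.cov).nat.map x * (NerveCover.prodSnd U.cov V.cov).nat.map y)

theorem mulAux_eq {U V W : NerveCover.Adm G} (θ : NerveCover.Refinement W.cov U.cov)
    (η : NerveCover.Refinement W.cov V.cov) (x : U.cov.nat.HR1ss S) (y : V.cov.nat.HR1ss S) :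
    mulAux U V x y = of W (θ.nat.map x * η.nat.map y) := by
  have h1 := NerveCover.Refinement.map_comp (NerveCover.prodFst U.cov V.cov) (θ.pair η) x
  have h2 := NerveCover.Refinement.map_comp (NerveCover.prodSnd U.cov V.cov) (θ.pair η) y
  refine (of_map (U := U.prod V) (W := W) (θ.pair η) _).symm.trans (congrArg (of W) ?_)
  exact (PreSimplicialCover.Refinement.map_mul _ _ _).trans
    (congrArg₂ (· * ·) h1.symm h2.symm)

instance : Mul (CechHR1 G S) :=
  ⟨Quot.lift₂ (fun p q => mulAux p.1 q.1 p.2 q.2)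
    (by
      rintro ⟨U, x⟩ _ _ ⟨V, W, θ, y⟩
      exact (mulAux_eq (W := U.prod W) (NerveCover.prodFst _ _)
        (θ.comp (NerveCover.prodSnd U.cov W.cov)) x y).trans
        (congrArg (fun z => of (U.prod W) ((NerveCover.prodFst U.cov W.cov).nat.map x * z))
          (NerveCover.Refinement.map_comp θ (NerveCover.prodSnd U.cov W.cov) y)))
    (by
      rintro _ _ ⟨V, y⟩ ⟨U, W, θ, x⟩
      exact (mulAux_eq (W := W.prod V) (θ.comp (NerveCover.prodFst W.cov V.cov))
        (NerveCover.prodSnd _ _) x y).trans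
        (congrArg (fun z => of (W.prod V) (z * (NerveCover.prodSnd W.cov V.cov).nat.map y))
          (NerveCover.Refinement.map_comp θ (NerveCover.prodFst W.cov V.cov) x)))⟩

theorem of_mul_of {U V W : NerveCover.Adm G} (θ : NerveCover.Refinement W.cov U.cov)
    (η : NerveCover.Refinement W.cov V.cov) (x : U.cov.nat.HR1ss S) (y : V.cov.nat.HR1ss S) :
    of U x * of V y = of W (θ.nat.map x * η.nat.map y) :=
  mulAux_eq θ η x y

theorem of_mul (W : NerveCover.Adm G) (x y : W.cov.nat.HR1ss S) :
    of W x * of W y = of W (x * y) := by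
  rw [of_mul_of (W := W) ⟨fun _ i => i, fun _ _ => rfl, fun _ _ => subset_rfl⟩
    ⟨fun _ i => i, fun _ _ => rfl, fun _ _ => subset_rfl⟩]
  congr 2
  · induction x using Quotient.inductionOn; rfl
  · induction y using Quotient.inductionOn; rfl

instance : One (CechHR1 G S) := ⟨of (NerveCover.Adm.trivial G) 1⟩

theorem of_one (W : NerveCover.Adm G) : of W (1 : W.cov.nat.HR1ss S) = 1 :=
  (congrArg (of W) (PreSimplicialCover.Refinement.map_one _)).symm.trans
    (of_map (U := NerveCover.Adm.trivial G) (NerveCover.Refinement.toTrivial W.cov) 1)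

instance : Inv (CechHR1 G S) :=
  ⟨Quot.lift (fun p => of p.1 p.2⁻¹) (by
    rintro _ _ ⟨U, W, θ, x⟩
    rw [← PreSimplicialCover.Refinement.map_inv, of_map])⟩

theorem of_inv (W : NerveCover.Adm G) (x : W.cov.nat.HR1ss S) : (of W x)⁻¹ = of W x⁻¹ := rfl

/-- Two classes come from the same cover. -/
theorem ind₂ {C : CechHR1 G S → CechHR1 G S → Prop} (h : ∀ W x y, C (of W x) (of W y))
    (a b : CechHR1 G S) : C a b := by
  induction a using ind with | _ U x
  induction b using ind with | _ V y
  rw [← of_map (W := U.prod V) (NerveCover.prodFst U.cov V.cov) x,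
    ← of_map (W := U.prod V) (NerveCover.prodSnd U.cov V.cov) y]
  exact h _ _ _

/-- Three classes come from the same cover. -/
theorem ind₃ {C : CechHR1 G S → CechHR1 G S → CechHR1 G S → Prop}
    (h : ∀ W x y z, C (of W x) (of W y) (of W z)) (a b c : CechHR1 G S) : C a b c := by
  induction a, b using ind₂ with | _ U x y
  induction c using ind with | _ V z
  rw [← of_map (W := U.prod V) (NerveCover.prodFst U.cov V.cov) x,
    ← of_map (W := U.prod V) (NerveCover.prodFst U.cov V.cov) y,
    ← of_map (W := U.prod V) (NerveCover.prodSnd U.cov V.cov) z]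
  exact h _ _ _ _

/-- For commutative `S`, the first Real Čech cohomology is a group. -/
instance : CommGroup (CechHR1 G S) where
  mul_assoc a b c := by
    induction a, b, c using ind₃ with | _ W x y z
    simp only [of_mul, mul_assoc]
  one_mul a := by
    induction a using ind with | _ W x
    rw [← of_one W, of_mul, one_mul]
  mul_one a := by
    induction a using ind with | _ W x
    rw [← of_one W, of_mul, mul_one]
  inv_mul_cancel a := by
    induction a using ind with | _ W x
    rw [of_inv, of_mul, inv_mul_cancel, of_one]
  mul_comm a b := by
    induction a, b using ind₂ with | _ W x y
    rw [of_mul, of_mul, mul_comm]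

end CommGroup

end CechHR1

/-- `s` is a Real family of continuous local sections of `rng : Z → X` over the cover in degree `0`,
and `c` is its transition cocycle: `g · s_{j₁}(s(g)) = s_{j₀}(r(g)) · c_{j₀j₁}(g)`. -/
structure RealGenHom.IsTransition {G : RealGroupoid.{u}} {S : Type u} [Group S]
    [TopologicalSpace S] [RealGroup S] (Z : RealGenHom G (RealGroupoid.ofGroup S))
    (V : PreSimplicialCover G) (s : ∀ j : (V.cov 0).J, C((V.cov 0).U j, Z.Z))
    (c : V.ZR1 S) : Prop where
  rng_s : ∀ j x, Z.rng (s j x) = x.1.obj 0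
  s_bar : ∀ j x (hx : x ∈ (V.cov 0).U j),
    s ((V.cov 0).bar j) ⟨Nerve.ρ x, (V.cov 0).mem_bar hx⟩ = Z.τ (s j ⟨x, hx⟩)
  lact_s : ∀ j x (hx : x ∈ (V.cov 1).U j) (e : G.s (x.arr 0 1) =
      Z.rng (s _ ⟨_, V.face_mem (PreSimplicialCover.ε 0) j x hx⟩)),
    Z.lact (x.arr 0 1) (s _ ⟨_, V.face_mem (PreSimplicialCover.ε 0) j x hx⟩) e =
      Z.act (s _ ⟨_, V.face_mem (PreSimplicialCover.ε 1) j x hx⟩) (c.1.1 j ⟨x, hx⟩)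

/-!
Over `♮U` a point of the nerve lies in many members with the same vertex indices, but the cocycle
identity on degenerate strings forces the value `c_λ(g)` of a `1`-cocycle to depend only on the
indices of the two vertices of `λ`. A `1`-cocycle is therefore the same as a Haefliger cocycle: a
family of maps `f_{ab}(γ)`, for `r(γ) ∈ U_a` and `s(γ) ∈ U_b`, with
`f_{ac}(γγ') = f_{ab}(γ) f_{bc}(γ')`. On units `f` is a transition cocycle of a principal bundle
over `X`, and on arrows it defines the action of `G` on that bundle. Conversely, Real local sections
`σ_a` of a Real generalized homomorphism satisfy `γ · σ_b(s(γ)) = σ_a(r(γ)) · f_{ab}(γ)` for a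
unique `f`, and `σ_a(x) · t ↦ σ'_a(x) · t` is an isomorphism between two bundles whose sections have
the same `f`.
-/

namespace RealGroupoid

variable (G : RealGroupoid.{u})

theorem mul_congr {g g' h h' : G.Arr} (hg : g = g') (hh : h = h') (e : G.s g = G.r h)
    (e' : G.s g' = G.r h') : G.mul g h e = G.mul g' h' e' := by
  subst hg hh; rfl

theorem inv_mul_cancel_left (g h : G.Arr) (e : G.s g = G.r h) :
    G.mul (G.inv g) (G.mul g h e) ((G.s_inv g).trans (G.r_mul g h e).symm) = h := by
  rw [← G.mul_assoc _ _ _ (G.s_inv g) e,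
    G.mul_congr ((G.inv_mul g).trans (congrArg G.unit e)) rfl _ (G.s_unit _), G.unit_mul]

theorem mul_inv_cancel_right (g h : G.Arr) (e : G.s g = G.r h)
    (e' : G.s (G.mul g h e) = G.r (G.inv h)) : G.mul (G.mul g h e) (G.inv h) e' = g := by
  rw [G.mul_assoc g h _ e (G.r_inv h).symm, G.mul_congr rfl ((G.mul_inv h).trans
    (congrArg G.unit e.symm)) _ (G.r_unit _).symm, G.mul_unit]

theorem inv_unit (x : G.Obj) : G.inv (G.unit x) = G.unit x := by
  rw [← G.unit_mul (G.inv (G.unit x)),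
    G.mul_congr (congrArg G.unit ((G.r_inv _).trans (G.s_unit x))) rfl _ (G.r_inv _).symm,
    G.mul_inv, G.r_unit]

theorem mul_inv_unit (g : G.Arr) (x : G.Obj) (e : G.s g = G.r (G.inv (G.unit x))) :
    G.mul g (G.inv (G.unit x)) e = g := by
  obtain rfl : G.s g = x := e.trans ((G.r_inv _).trans (G.s_unit x))
  rw [G.mul_congr rfl (G.inv_unit _) _ (G.r_unit _).symm, G.mul_unit]

namespace Nerve

variable {G} {n : ℕ}

theorem continuous_obj (i : Fin (n + 1)) : Continuous fun x : Nerve G n => x.obj i :=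
  (continuous_apply i).comp (continuous_fst.comp continuous_pair)

theorem continuous_arr (i j : Fin (n + 1)) : Continuous fun x : Nerve G n => x.arr i j :=
  (continuous_apply j).comp ((continuous_apply i).comp (continuous_snd.comp continuous_pair))

theorem arr_eq_inv_mul (x : Nerve G n) (i j k : Fin (n + 1)) :
    x.arr j k = G.mul (G.inv (x.arr i j)) (x.arr i k)
      ((G.s_inv _).trans ((x.r_arr i j).trans (x.r_arr i k).symm)) := by
  rw [← G.inv_mul_cancel_left (x.arr i j) (x.arr j k) ((x.s_arr i j).trans (x.r_arr j k).symm)]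
  exact G.mul_congr rfl (x.arr_mul i j k) _ _

theorem ext_of_arr_eq {x y : Nerve G n} (i : Fin (n + 1)) (h : ∀ j, x.arr i j = y.arr i j) :
    x = y :=
  Nerve.ext (funext fun j => by rw [← x.s_arr i j, h, y.s_arr]) <|
    funext fun j => funext fun k => by
    rw [x.arr_eq_inv_mul i, y.arr_eq_inv_mul i]
    exact G.mul_congr (congrArg G.inv (h j)) (h k) _ _

theorem ext_obj {x y : Nerve G 0} (h : x.obj 0 = y.obj 0) : x = y :=
  ext_of_arr_eq 0 fun j => by rw [Fin.fin_one_eq_zero j, x.arr_self, y.arr_self, h]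

theorem ext_arr {x y : Nerve G 1} (h : x.arr 0 1 = y.arr 0 1) : x = y :=
  ext_of_arr_eq 0 fun j =>
    match j with
    | 0 => by rw [x.arr_self, y.arr_self, ← x.r_arr 0 1, ← y.r_arr 0 1, h]
    | 1 => h

/-- The string of arrows `aᵢ aⱼ⁻¹` defined by arrows `aᵢ` with the same source. -/
def cone (a : Fin (n + 1) → G.Arr) (h : ∀ i j, G.s (a i) = G.s (a j)) : Nerve G n where
  obj i := G.r (a i)
  arr i j := G.mul (a i) (G.inv (a j)) ((h i j).trans (G.r_inv _).symm)
  r_arr i j := G.r_mul _ _ _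
  s_arr i j := (G.s_mul _ _ _).trans (G.s_inv _)
  arr_self i := G.mul_inv _
  arr_mul i j k := by
    have e : G.s (G.inv (a j)) = G.r (G.mul (a j) (G.inv (a k)) ((h j k).trans (G.r_inv _).symm)) :=
      (G.s_inv _).trans (G.r_mul _ _ _).symm
    rw [G.mul_assoc _ _ _ ((h i j).trans (G.r_inv _).symm) e]
    exact G.mul_congr rfl (G.inv_mul_cancel_left _ _ _) _ _

theorem continuous_cone {T : Type*} [TopologicalSpace T] {a : T → Fin (n + 1) → G.Arr}
    (ha : ∀ i, Continuous fun t => a t i) (h : ∀ t i j, G.s (a t i) = G.s (a t j)) :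
    Continuous fun t => cone (a t) (h t) := by
  refine continuous_induced_rng.2 (Continuous.prodMk ?_ ?_)
  · exact continuous_pi fun i => G.continuous_r.comp (ha i)
  · refine continuous_pi fun i => continuous_pi fun j => G.continuous_mul.comp
      (f := fun t => ⟨(a t i, G.inv (a t j)), (h t i j).trans (G.r_inv _).symm⟩) ?_
    exact ((ha i).prodMk (G.continuous_inv.comp (ha j))).subtype_mk _

/-- A unit, as a string of no arrows. -/
def ofObj (x : G.Obj) : Nerve G 0 := cone (fun _ => G.unit x) fun _ _ => rfl

/-- An arrow, as a string of one arrow. -/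
def ofArr (g : G.Arr) : Nerve G 1 := cone ![g, G.unit (G.s g)] (by simp [G.s_unit])

/-- A composable pair of arrows, as a string of two arrows. -/
def ofPair (g h : G.Arr) (e : G.s g = G.r h) : Nerve G 2 :=
  cone ![G.mul g h e, h, G.unit (G.s h)] (by simp [Fin.forall_fin_succ, G.s_unit, G.s_mul])

theorem continuous_ofObj : Continuous (ofObj : G.Obj → Nerve G 0) :=
  continuous_cone (fun _ => G.continuous_unit) _

theorem continuous_ofArr : Continuous (ofArr : G.Arr → Nerve G 1) :=
  continuous_cone (fun i =>
    match i with
    | 0 => continuous_id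
    | 1 => G.continuous_unit.comp G.continuous_s) _

@[simp]
theorem obj_ofObj (x : G.Obj) : (ofObj x).obj 0 = x := G.r_unit x

@[simp]
theorem ofObj_obj (x : Nerve G 0) : ofObj (x.obj 0) = x := ext_obj (obj_ofObj _)

@[simp]
theorem ρ_ofObj (x : G.Obj) : ρ (ofObj x) = ofObj (G.ρ₀ x) :=
  ext_obj ((congrArg G.ρ₀ (obj_ofObj x)).trans (obj_ofObj _).symm)

@[simp]
theorem arr_ofArr (g : G.Arr) : (ofArr g).arr 0 1 = g := G.mul_inv_unit g (G.s g) _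

@[simp]
theorem ofArr_arr (x : Nerve G 1) : ofArr (x.arr 0 1) = x := ext_arr (arr_ofArr _)

@[simp]
theorem obj_one_ofArr (g : G.Arr) : (ofArr g).obj 1 = G.s g := G.r_unit _

@[simp]
theorem ρ_ofArr (g : G.Arr) : ρ (ofArr g) = ofArr (G.ρ g) :=
  ext_arr ((congrArg G.ρ (arr_ofArr g)).trans (arr_ofArr _).symm)

theorem face_eq_ofObj (x : Nerve G n) (f : Fin (0 + 1) → Fin (n + 1)) :
    face f x = ofObj (x.obj (f 0)) :=
  (ofObj_obj (face f x)).symm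

theorem face_eq_ofArr (x : Nerve G n) (f : Fin (1 + 1) → Fin (n + 1)) :
    face f x = ofArr (x.arr (f 0) (f 1)) :=
  (ofArr_arr (face f x)).symm

theorem face_zero_ofPair (g h : G.Arr) (e : G.s g = G.r h) :
    face (Fin.succAbove (n := 1 + 1) 0) (ofPair g h e) = ofArr h :=
  ext_arr ((G.mul_inv_unit h (G.s h) _).trans (arr_ofArr h).symm)

theorem face_one_ofPair (g h : G.Arr) (e : G.s g = G.r h) :
    face (Fin.succAbove (n := 1 + 1) 1) (ofPair g h e) = ofArr (G.mul g h e) :=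
  ext_arr ((G.mul_inv_unit (G.mul g h e) (G.s h) _).trans (arr_ofArr _).symm)

theorem face_two_ofPair (g h : G.Arr) (e : G.s g = G.r h) :
    face (Fin.succAbove (n := 1 + 1) 2) (ofPair g h e) = ofArr g :=
  ext_arr ((G.mul_inv_cancel_right g h e _).trans (arr_ofArr g).symm)

end Nerve

end RealGroupoid

theorem RealCover.U_bar_eq_preimage {X : Type u} [TopologicalSpace X] {ρ : X → X}
    (hρ : Function.Involutive ρ) (V : RealCover X ρ) (j : V.J) : V.U (V.bar j) = ρ ⁻¹' V.U j := by
  rw [V.U_bar, image_eq_preimage_of_inverse hρ.leftInverse hρ.rightInverse]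

namespace NerveCover

open PreSimplicialCover (ε)

variable {G : RealGroupoid.{u}} {U : NerveCover G} {n : ℕ}

/-- The Real open cover of the space of units given by the degree `0` part of a cover of the
nerve. -/
def baseCover (U : NerveCover G) : RealCover G.Obj G.ρ₀ where
  J := (U 0).J
  bar := (U 0).bar
  bar_bar := (U 0).bar_bar
  U a := Nerve.ofObj ⁻¹' (U 0).U a
  isOpen_U a := ((U 0).isOpen_U a).preimage Nerve.continuous_ofObj
  exists_mem x := (U 0).exists_mem (Nerve.ofObj x)
  U_bar a := by
    rw [image_eq_preimage_of_inverse G.ρ₀_ρ₀ G.ρ₀_ρ₀, (U 0).U_bar_eq_preimage Nerve.ρ_ρ]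
    ext x
    simp only [mem_preimage, Nerve.ρ_ofObj]

/-- The inclusion of the vertex `i`. -/
def vertexEmb (i : Fin (n + 1)) : Fin (0 + 1) ↪o Fin (n + 1) :=
  OrderEmbedding.ofStrictMono (fun _ => i) fun a b h => by omega

theorem eq_vertexEmb (φ : Fin (0 + 1) ↪o Fin (n + 1)) : φ = vertexEmb (φ 0) :=
  RelEmbedding.ext fun i => by rw [Fin.fin_one_eq_zero i]; rfl

theorem eq_refl_of_orderEmbedding (φ : Fin (n + 1) ↪o Fin (n + 1)) : φ = RelEmbedding.refl _ :=
  RelEmbedding.ext <| congrFun <| (φ.strictMono.range_inj strictMono_id).1 <| by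
    rw [(Finite.injective_iff_surjective.1 φ.injective).range_eq, range_id]

theorem le_of_orderEmbedding {k : ℕ} (φ : Fin (k + 1) ↪o Fin (n + 1)) : k ≤ n := by
  simpa using Fintype.card_le_of_injective φ φ.injective

/-- The member of the cover of the units that an index of `♮U` prescribes at the vertex `i`. -/
def vertex (l : (U.nat.cov n).J) (i : Fin (n + 1)) : U.baseCover.J := l 0 (vertexEmb i)

/-- The member of the cover of the arrows that an index of `♮U` in degree `1` prescribes. -/
def edge (l : (U.nat.cov 1).J) : (U 1).J := l 1 (RelEmbedding.refl _)

theorem vertex_mem {l : (U.nat.cov n).J} {x : Nerve G n} (hx : x ∈ (U.nat.cov n).U l)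
    (i : Fin (n + 1)) : x.obj i ∈ U.baseCover.U (vertex l i) := by
  have h := hx 0 (vertexEmb i)
  rwa [Nerve.face_eq_ofObj] at h

theorem r_arr_mem {l : (U.nat.cov n).J} {x : Nerve G n} (hx : x ∈ (U.nat.cov n).U l)
    (i j : Fin (n + 1)) : G.r (x.arr i j) ∈ U.baseCover.U (vertex l i) :=
  (x.r_arr i j).symm ▸ vertex_mem hx i

theorem s_arr_mem {l : (U.nat.cov n).J} {x : Nerve G n} (hx : x ∈ (U.nat.cov n).U l)
    (i j : Fin (n + 1)) : G.s (x.arr i j) ∈ U.baseCover.U (vertex l j) :=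
  (x.s_arr i j).symm ▸ vertex_mem hx j

theorem edge_mem {l : (U.nat.cov 1).J} {x : Nerve G 1} (hx : x ∈ (U.nat.cov 1).U l) :
    x ∈ (U 1).U (edge l) :=
  hx 1 (RelEmbedding.refl _)

theorem index_ext_zero {l l' : (U.nat.cov 0).J} (h : vertex l 0 = vertex l' 0) : l = l' := by
  funext k φ
  obtain rfl : k = 0 := Nat.le_zero.1 (le_of_orderEmbedding φ)
  rw [eq_vertexEmb φ, Fin.fin_one_eq_zero (φ 0)]
  exact h

theorem index_ext_one {l l' : (U.nat.cov 1).J} (h0 : vertex l 0 = vertex l' 0)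
    (h1 : vertex l 1 = vertex l' 1) (h : edge l = edge l') : l = l' := by
  funext k φ
  match k with
  | 0 =>
    rw [eq_vertexEmb φ]
    match φ 0 with
    | 0 => exact h0
    | 1 => exact h1
  | 1 => rw [eq_refl_of_orderEmbedding φ]; exact h
  | k + 2 => exact absurd (le_of_orderEmbedding φ) (by omega)

theorem exists_index_of_vertex_edge {x : Nerve G n} (a : Fin (n + 1) → U.baseCover.J)
    (j : Fin (n + 1) → Fin (n + 1) → (U 1).J) (ha : ∀ i, x.obj i ∈ U.baseCover.U (a i))
    (hj : ∀ i k, i < k → Nerve.ofArr (x.arr i k) ∈ (U 1).U (j i k)) :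
    ∃ l : (U.nat.cov n).J, x ∈ (U.nat.cov n).U l ∧ (∀ φ, l 0 φ = a (φ 0)) ∧
      ∀ φ, l 1 φ = j (φ 0) (φ 1) := by
  refine ⟨fun k φ =>
    match k, φ with
    | 0, φ => a (φ 0)
    | 1, φ => j (φ 0) (φ 1)
    | k + 2, φ => ((U (k + 2)).exists_mem (Nerve.face φ x)).choose,
    fun k φ => ?_, fun _ => rfl, fun _ => rfl⟩
  match k, φ with
  | 0, φ => rw [Nerve.face_eq_ofObj]; exact ha _
  | 1, φ => rw [Nerve.face_eq_ofArr]; exact hj _ _ (φ.strictMono Fin.zero_lt_one)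
  | k + 2, φ => exact ((U (k + 2)).exists_mem (Nerve.face φ x)).choose_spec

theorem exists_index_of_vertex {x : Nerve G n} (a : Fin (n + 1) → U.baseCover.J)
    (ha : ∀ i, x.obj i ∈ U.baseCover.U (a i)) :
    ∃ l : (U.nat.cov n).J, x ∈ (U.nat.cov n).U l ∧ vertex l = a := by
  obtain ⟨l, hl, h, -⟩ := exists_index_of_vertex_edge a
    (fun i k => ((U 1).exists_mem (Nerve.ofArr (x.arr i k))).choose) ha
    fun i k _ => ((U 1).exists_mem (Nerve.ofArr (x.arr i k))).choose_spec
  exact ⟨l, hl, funext fun i => h (vertexEmb i)⟩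

theorem exists_index_of_faces {y : Nerve G 2} {k l m : (U.nat.cov 1).J}
    (hk : Nerve.face (ε (n := 1) 1) y ∈ (U.nat.cov 1).U k)
    (hl : Nerve.face (ε (n := 1) 2) y ∈ (U.nat.cov 1).U l)
    (hm : Nerve.face (ε (n := 1) 0) y ∈ (U.nat.cov 1).U m) (hkl : vertex k 0 = vertex l 0)
    (hlm : vertex l 1 = vertex m 0) (hkm : vertex k 1 = vertex m 1) :
    ∃ p : (U.nat.cov 2).J, y ∈ (U.nat.cov 2).U p ∧ U.nat.face (ε 1) p = k ∧
      U.nat.face (ε 2) p = l ∧ U.nat.face (ε 0) p = m := by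
  obtain ⟨p, hp, hv, he⟩ := exists_index_of_vertex_edge (x := y)
    ![vertex l 0, vertex l 1, vertex m 1]
    ![![edge l, edge l, edge k], ![edge l, edge l, edge m], ![edge l, edge l, edge l]]
    (fun i =>
      match i with
      | 0 => vertex_mem hl 0
      | 1 => vertex_mem hl 1
      | 2 => vertex_mem hm 1)
    fun i j hij => by
      have hij : (i = 0 ∧ j = 1) ∨ (i = 0 ∧ j = 2) ∨ (i = 1 ∧ j = 2) := by
        revert i j; decide
      obtain ⟨rfl, rfl⟩ | ⟨rfl, rfl⟩ | ⟨rfl, rfl⟩ := hij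
      · exact Nerve.face_eq_ofArr y (ε 2) ▸ edge_mem hl
      · exact Nerve.face_eq_ofArr y (ε 1) ▸ edge_mem hk
      · exact Nerve.face_eq_ofArr y (ε 0) ▸ edge_mem hm
  exact ⟨p, hp, index_ext_one ((hv _).trans hkl.symm) ((hv _).trans hkm.symm) (he _),
    index_ext_one (hv _) (hv _) (he _), index_ext_one ((hv _).trans hlm) (hv _) (he _)⟩

variable {S : Type u} [Group S] [TopologicalSpace S] [RealGroup S] (c : U.nat.ZR1 S)

theorem cocycle_apply_mul {y : Nerve G 2} {x₀ x₁ x₂ : Nerve G 1} {k l m : (U.nat.cov 1).J}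
    (hy₁ : Nerve.face (ε (n := 1) 1) y = x₁) (hy₂ : Nerve.face (ε (n := 1) 2) y = x₂)
    (hy₀ : Nerve.face (ε (n := 1) 0) y = x₀) (hk : x₁ ∈ (U.nat.cov 1).U k)
    (hl : x₂ ∈ (U.nat.cov 1).U l) (hm : x₀ ∈ (U.nat.cov 1).U m) (hkl : vertex k 0 = vertex l 0)
    (hlm : vertex l 1 = vertex m 0) (hkm : vertex k 1 = vertex m 1) :
    c.1.1 k ⟨x₁, hk⟩ = c.1.1 l ⟨x₂, hl⟩ * c.1.1 m ⟨x₀, hm⟩ := by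
  subst hy₁ hy₂ hy₀
  obtain ⟨p, hp, rfl, rfl, rfl⟩ := exists_index_of_faces hk hl hm hkl hlm hkm
  exact congrArg (fun f => f ⟨y, hp⟩) (c.2 p)

theorem cocycle_apply_eq_of_vertex_eq {l m : (U.nat.cov 1).J} {x : Nerve G 1}
    (hl : x ∈ (U.nat.cov 1).U l) (hm : x ∈ (U.nat.cov 1).U m) (h : vertex l = vertex m) :
    c.1.1 l ⟨x, hl⟩ = c.1.1 m ⟨x, hm⟩ := by
  -- The degenerate string `(x, 1)` compares both values with the same third value.
  let y : Nerve G 2 := Nerve.face ![0, 1, 1] x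
  obtain ⟨u, hu, hvu⟩ := exists_index_of_vertex (x := Nerve.face (ε (n := 1) 0) y)
    (fun _ => vertex m 1) fun i => match i with
      | 0 => vertex_mem hm 1
      | 1 => vertex_mem hm 1
  have apply_eq {k} (hk : x ∈ (U.nat.cov 1).U k) (h : vertex k = vertex m) :
      c.1.1 k ⟨x, hk⟩ = c.1.1 m ⟨x, hm⟩ * c.1.1 u ⟨_, hu⟩ :=
    cocycle_apply_mul c (y := y) (x₁ := x) (x₂ := x) (Nerve.ext_arr rfl) (Nerve.ext_arr rfl) rfl
      hk hm hu (congrFun h 0) (by rw [hvu]) (by rw [hvu, h])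
  rw [apply_eq hl h, ← apply_eq hm rfl]

end NerveCover

/-- A Real Haefliger cocycle: functions `f a b g` of the arrows `g` from `U b` to `U a`, for a
Real open cover of the units. The values at all other arrows are junk. -/
structure ArrowCocycle {G : RealGroupoid.{u}} (B : RealCover G.Obj G.ρ₀) (S : Type u) [Group S]
    [TopologicalSpace S] [RealGroup S] where
  toFun : B.J → B.J → G.Arr → S
  continuousOn : ∀ a b, ContinuousOn (toFun a b) (G.r ⁻¹' B.U a ∩ G.s ⁻¹' B.U b)
  map_mul : ∀ {a b d : B.J} {g h : G.Arr} (e : G.s g = G.r h), G.r g ∈ B.U a → G.s g ∈ B.U b →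
    G.s h ∈ B.U d → toFun a d (G.mul g h e) = toFun a b g * toFun b d h
  map_ρ : ∀ {a b : B.J} {g : G.Arr}, G.r g ∈ B.U a → G.s g ∈ B.U b →
    toFun (B.bar a) (B.bar b) (G.ρ g) = RealGroup.conj (toFun a b g)

namespace ArrowCocycle

variable {G : RealGroupoid.{u}} {S : Type u} [Group S] [TopologicalSpace S] [RealGroup S]

instance {B : RealCover G.Obj G.ρ₀} :
    CoeFun (ArrowCocycle B S) fun _ => B.J → B.J → G.Arr → S :=
  ⟨toFun⟩

section Unit

variable {B : RealCover G.Obj G.ρ₀} (f : ArrowCocycle B S)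

theorem map_mul_unit {a b d : B.J} {g : G.Arr} {x : G.Obj} (hx : G.s g = x) (ha : G.r g ∈ B.U a)
    (hb : x ∈ B.U b) (hd : x ∈ B.U d) : f a b g * f b d (G.unit x) = f a d g := by
  subst hx
  rw [← f.map_mul (G.r_unit _).symm ha hb (by rwa [G.s_unit]), G.mul_unit]

theorem map_unit_mul {a b d : B.J} {g : G.Arr} {x : G.Obj} (hx : G.r g = x) (ha : x ∈ B.U a)
    (hb : x ∈ B.U b) (hd : G.s g ∈ B.U d) : f a b (G.unit x) * f b d g = f a d g := by
  subst hx
  rw [← f.map_mul (G.s_unit _) (by rwa [G.r_unit]) (by rwa [G.s_unit]) hd, G.unit_mul]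

theorem map_unit {a : B.J} {x : G.Obj} (ha : x ∈ B.U a) : f a a (G.unit x) = 1 :=
  mul_eq_left.1 (f.map_mul_unit (G.s_unit x) (by rwa [G.r_unit]) ha ha)

theorem continuousOn_unit (a b : B.J) :
    ContinuousOn (fun x => f a b (G.unit x)) (B.U a ∩ B.U b) :=
  (f.continuousOn a b).comp G.continuous_unit.continuousOn fun x hx => by
    simpa [G.r_unit, G.s_unit] using hx

end Unit

variable {U : NerveCover G}

open NerveCover (vertex r_arr_mem s_arr_mem)

/-- The cocycle over `♮U` defined by a cocycle over the cover of the units. -/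
def nat (f : ArrowCocycle U.baseCover S) : U.nat.ZR1 S where
  val :=
    { val := fun l =>
        { toFun := fun x => f (vertex l 0) (vertex l 1) (x.1.arr 0 1)
          continuous_toFun := (f.continuousOn _ _).comp_continuous
            ((Nerve.continuous_arr 0 1).comp continuous_subtype_val) fun x =>
              ⟨r_arr_mem x.2 0 1, s_arr_mem x.2 0 1⟩ }
      property := fun l x hx => f.map_ρ (r_arr_mem hx 0 1) (s_arr_mem hx 0 1) }
  property p := by
    ext ⟨x, hx⟩
    exact (congrArg _ (x.arr_mul 0 1 2).symm).trans <| f.map_mul _ (r_arr_mem hx 0 1)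
      (s_arr_mem hx 0 1) (s_arr_mem hx 1 2)

end ArrowCocycle

namespace NerveCover

variable {G : RealGroupoid.{u}} {U : NerveCover G} {S : Type u} [Group S] [TopologicalSpace S]
  [RealGroup S] (c : U.nat.ZR1 S)

theorem exists_index_of_arr {a b : U.baseCover.J} {g : G.Arr} (ha : G.r g ∈ U.baseCover.U a)
    (hb : G.s g ∈ U.baseCover.U b) :
    ∃ l : (U.nat.cov 1).J, Nerve.ofArr g ∈ (U.nat.cov 1).U l ∧ vertex l = ![a, b] :=
  exists_index_of_vertex _ fun i =>
    match i with
    | 0 => ha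
    | 1 => (Nerve.obj_one_ofArr g).symm ▸ hb

open Classical in
/-- The value of the cocycle `c` at an arrow, for any index with the vertices `a` and `b`; it is
`1` if there is no such index. -/
noncomputable def arrowValue (a b : U.baseCover.J) (g : G.Arr) : S :=
  if h : ∃ l : (U.nat.cov 1).J, Nerve.ofArr g ∈ (U.nat.cov 1).U l ∧ vertex l = ![a, b] then
    c.1.1 h.choose ⟨Nerve.ofArr g, h.choose_spec.1⟩
  else 1

theorem arrowValue_eq {a b : U.baseCover.J} {g : G.Arr} {l : (U.nat.cov 1).J}
    (hl : Nerve.ofArr g ∈ (U.nat.cov 1).U l) (h : vertex l = ![a, b]) :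
    arrowValue c a b g = c.1.1 l ⟨Nerve.ofArr g, hl⟩ := by
  have hex : ∃ l : (U.nat.cov 1).J, Nerve.ofArr g ∈ (U.nat.cov 1).U l ∧ vertex l = ![a, b] :=
    ⟨l, hl, h⟩
  rw [arrowValue, dif_pos hex]
  exact cocycle_apply_eq_of_vertex_eq c _ hl (hex.choose_spec.2.trans h.symm)

theorem continuousOn_arrowValue (a b : U.baseCover.J) :
    ContinuousOn (arrowValue c a b) (G.r ⁻¹' U.baseCover.U a ∩ G.s ⁻¹' U.baseCover.U b) := by
  rintro g ⟨ha, hb⟩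
  obtain ⟨l, hl, hv⟩ := exists_index_of_arr ha hb
  have hcont : ContinuousOn (arrowValue c a b) (Nerve.ofArr ⁻¹' (U.nat.cov 1).U l) := by
    rw [continuousOn_iff_continuous_domRestrict]
    refine ((c.1.1 l).continuous.comp ((Nerve.continuous_ofArr.comp
      continuous_subtype_val).subtype_mk Subtype.property)).congr fun h => ?_
    exact (arrowValue_eq c h.2 hv).symm
  exact (hcont.continuousAt ((((U.nat.cov 1).isOpen_U l).preimage
    Nerve.continuous_ofArr).mem_nhds hl)).continuousWithinAt

theorem arrowValue_mul {a b d : U.baseCover.J} {g h : G.Arr} (e : G.s g = G.r h)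
    (ha : G.r g ∈ U.baseCover.U a) (hb : G.s g ∈ U.baseCover.U b) (hd : G.s h ∈ U.baseCover.U d) :
    arrowValue c a d (G.mul g h e) = arrowValue c a b g * arrowValue c b d h := by
  obtain ⟨l, hl, hlv⟩ := exists_index_of_arr ha hb
  obtain ⟨m, hm, hmv⟩ := exists_index_of_arr (e ▸ hb) hd
  obtain ⟨k, hk, hkv⟩ := exists_index_of_arr (g := G.mul g h e) (a := a) (b := d)
    (by rwa [G.r_mul]) (by rwa [G.s_mul])
  rw [arrowValue_eq c hk hkv, arrowValue_eq c hl hlv, arrowValue_eq c hm hmv]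
  exact cocycle_apply_mul c (Nerve.face_one_ofPair g h e) (Nerve.face_two_ofPair g h e)
    (Nerve.face_zero_ofPair g h e) hk hl hm (by rw [hkv, hlv]; rfl) (by rw [hlv, hmv]; rfl)
    (by rw [hkv, hmv]; rfl)

theorem arrowValue_ρ {a b : U.baseCover.J} {g : G.Arr} (ha : G.r g ∈ U.baseCover.U a)
    (hb : G.s g ∈ U.baseCover.U b) :
    arrowValue c (U.baseCover.bar a) (U.baseCover.bar b) (G.ρ g) =
      RealGroup.conj (arrowValue c a b g) := by
  obtain ⟨l, hl, hv⟩ := exists_index_of_arr ha hb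
  have hl' := (U.nat.cov 1).mem_bar hl
  have hv' : vertex ((U.nat.cov 1).bar l) = ![U.baseCover.bar a, U.baseCover.bar b] :=
    funext fun i => (congrArg U.baseCover.bar (congrFun hv i)).trans <|
      match i with
      | 0 => rfl
      | 1 => rfl
  rw [arrowValue_eq c hl hv, ← c.1.2 l _ hl, arrowValue_eq c (Nerve.ρ_ofArr g ▸ hl') hv']
  exact congrArg _ (Subtype.ext (Nerve.ρ_ofArr g).symm)

/-- The cocycle over the cover of the units given by a cocycle over `♮U`. -/
noncomputable def arrowCocycle : ArrowCocycle U.baseCover S where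
  toFun := arrowValue c
  continuousOn := continuousOn_arrowValue c
  map_mul := arrowValue_mul c
  map_ρ := arrowValue_ρ c

theorem nat_arrowCocycle : (arrowCocycle c).nat = c := by
  refine Subtype.ext (Subtype.ext (funext fun l => ContinuousMap.ext fun x => ?_))
  have hx : Nerve.ofArr (x.1.arr 0 1) = x.1 := Nerve.ofArr_arr x.1
  refine (arrowValue_eq c (hx.symm ▸ x.2) ?_).trans (congrArg _ (Subtype.ext hx))
  exact funext fun i =>
    match i with
    | 0 => rfl
    | 1 => rfl

end NerveCover

theorem t2Space_totalSpace {X F : Type*} {E : X → Type*} [TopologicalSpace X] [TopologicalSpace F]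
    [TopologicalSpace (Bundle.TotalSpace F E)] [∀ x, TopologicalSpace (E x)] [FiberBundle F E]
    [T2Space X] [T2Space F] : T2Space (Bundle.TotalSpace F E) := by
  refine t2Space_iff_disjoint_nhds.2 fun z w hzw => ?_
  by_cases h : z.proj = w.proj
  · let e := (trivializationAt F E z.proj).toOpenPartialHomeomorph
    have hz : z ∈ e.source := FiberBundle.mem_trivializationAt_proj_source
    have hw : w ∈ e.source :=
      (trivializationAt F E z.proj).mem_source.2 (h ▸ FiberBundle.mem_baseSet_trivializationAt' _)
    simp only [e.nhds_eq_comap_inf_principal hz, e.nhds_eq_comap_inf_principal hw]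
    exact (Filter.disjoint_comap (disjoint_nhds_nhds.2 (e.injOn.ne hz hw hzw))).mono inf_le_left
      inf_le_left
  · have hproj := FiberBundle.continuous_proj F E
    exact (Filter.disjoint_comap (disjoint_nhds_nhds.2 h)).mono hproj.continuousAt.le_comap
      hproj.continuousAt.le_comap

namespace ArrowCocycle

open RealGroupoid (ofGroup)

variable {G : RealGroupoid.{u}} {B : RealCover G.Obj G.ρ₀} {S : Type u} [Group S]
  [TopologicalSpace S] [RealGroup S] (f : ArrowCocycle B S)

/-- The gluing data of the bundle with the transition functions `x ↦ f a b (unit x)`. -/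
noncomputable def bundleCore : FiberBundleCore B.J G.Obj S where
  baseSet := B.U
  isOpen_baseSet := B.isOpen_U
  indexAt x := (B.exists_mem x).choose
  mem_baseSet_at x := (B.exists_mem x).choose_spec
  coordChange a b x t := f b a (G.unit x) * t
  coordChange_self a x hx t := by rw [f.map_unit hx, one_mul]
  continuousOn_coordChange a b :=
    ((f.continuousOn_unit b a).comp continuousOn_fst fun _ hp => ⟨hp.1.2, hp.1.1⟩).mul
      continuousOn_snd
  coordChange_comp a b d x hx t := by
    rw [← mul_assoc, f.map_unit_mul (G.r_unit x) hx.2 hx.1.2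
      (by simpa only [G.s_unit] using hx.1.1)]

/-- The principal bundle over the space of units glued from `B.U a × S` along the cocycle `f`. -/
abbrev BundleSpace : Type u := f.bundleCore.TotalSpace

namespace BundleSpace

/-- The index of a chart around `x`. -/
noncomputable abbrev index (x : G.Obj) : B.J := f.bundleCore.indexAt x

theorem mem_index (x : G.Obj) : x ∈ B.U (index f x) := f.bundleCore.mem_baseSet_at x

/-- The point over `x` with the coordinate `t` in the chart `a`. -/
noncomputable def pt (a : B.J) (x : G.Obj) (t : S) : f.BundleSpace :=
  ⟨x, (f (index f x) a (G.unit x) * t : S)⟩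

variable {f}

/-- The coordinate of a point in the chart `a`. -/
noncomputable def coord (a : B.J) (z : f.BundleSpace) : S :=
  f a (index f z.1) (G.unit z.1) * (show S from z.2)

theorem coord_pt {a b : B.J} {x : G.Obj} (ha : x ∈ B.U a) (hb : x ∈ B.U b) (t : S) :
    coord a (pt f b x t) = f a b (G.unit x) * t := by
  refine (mul_assoc (G := S) _ _ t).symm.trans (congrArg (· * t) ?_)
  exact f.map_unit_mul (G.r_unit x) ha (mem_index f x) (by rwa [G.s_unit])

theorem pt_coord {a : B.J} (z : f.BundleSpace) (h : z.1 ∈ B.U a) : pt f a z.1 (coord a z) = z := by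
  obtain ⟨x, t⟩ := z
  have hi := mem_index f x
  refine congrArg (Bundle.TotalSpace.mk x) ((mul_assoc (G := S) _ _ _).symm.trans ?_)
  rw [f.map_unit_mul (G.r_unit x) hi h (by rwa [G.s_unit]), f.map_unit hi]
  exact one_mul (M := S) t

theorem pt_eq_pt {a b : B.J} {x : G.Obj} (ha : x ∈ B.U a) (hb : x ∈ B.U b) (t : S) :
    pt f b x t = pt f a x (f a b (G.unit x) * t) := by
  rw [← coord_pt ha hb]
  exact (pt_coord (pt f b x t) ha).symm

theorem ind {C : f.BundleSpace → Prop} (h : ∀ a x (_ : x ∈ B.U a) t, C (pt f a x t))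
    (z : f.BundleSpace) : C z :=
  pt_coord z (mem_index f z.1) ▸ h _ _ (mem_index f z.1) _

theorem continuous_proj : Continuous fun z : f.BundleSpace => z.1 := f.bundleCore.continuous_proj

theorem continuousOn_pt (a : B.J) :
    ContinuousOn (fun p : G.Obj × S => pt f a p.1 p.2) (B.U a ×ˢ univ) := by
  have h := (f.bundleCore.localTriv a).toOpenPartialHomeomorph.symm.continuousOn
  rwa [OpenPartialHomeomorph.symm_source, Bundle.Trivialization.target_eq] at h

theorem continuousOn_coord (a : B.J) :
    ContinuousOn (coord (f := f) a) (Bundle.TotalSpace.proj ⁻¹' B.U a) := by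
  have h := (f.bundleCore.localTriv a).continuousOn_toFun
  rw [Bundle.Trivialization.source_eq] at h
  exact continuous_snd.comp_continuousOn h

section

variable {T : Type*} [TopologicalSpace T] {t₀ : T} {a : B.J}

theorem eventually_mem {g : T → f.BundleSpace} (hg : ContinuousAt g t₀) (ha : (g t₀).1 ∈ B.U a) :
    ∀ᶠ t in 𝓝 t₀, (g t).1 ∈ B.U a :=
  hg.preimage_mem_nhds (((B.isOpen_U a).preimage continuous_proj).mem_nhds ha)

theorem continuousAt_coord {g : T → f.BundleSpace} (hg : ContinuousAt g t₀)
    (ha : (g t₀).1 ∈ B.U a) : ContinuousAt (fun t => coord a (g t)) t₀ :=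
  ContinuousAt.comp (g := coord a) ((continuousOn_coord a).continuousAt
    (((B.isOpen_U a).preimage continuous_proj).mem_nhds ha)) hg

theorem continuousAt_of_pt {g : T → f.BundleSpace} {x : T → G.Obj} {t : T → S}
    (hx : ContinuousAt x t₀) (ht : ContinuousAt t t₀) (ha : x t₀ ∈ B.U a)
    (hg : ∀ᶠ y in 𝓝 t₀, g y = pt f a (x y) (t y)) : ContinuousAt g t₀ := by
  have hpt : ContinuousAt (fun p : G.Obj × S => pt f a p.1 p.2) (x t₀, t t₀) :=
    (continuousOn_pt a).continuousAt (((B.isOpen_U a).prod isOpen_univ).mem_nhds ⟨ha, mem_univ _⟩)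
  exact (ContinuousAt.comp (f := fun y => (x y, t y)) hpt (hx.prodMk ht)).congr
    (hg.mono fun _ hy => hy.symm)

end

variable (f) in
/-- The Real structure of the bundle. -/
noncomputable def τ (z : f.BundleSpace) : f.BundleSpace :=
  pt f (B.bar (index f z.1)) (G.ρ₀ z.1) (RealGroup.conj (coord (index f z.1) z))

/-- The action of an arrow on the bundle; the value is junk unless the arrow starts at the base
point. -/
noncomputable def lact (γ : G.Arr) (z : f.BundleSpace) : f.BundleSpace :=
  pt f (index f (G.r γ)) (G.r γ) (f (index f (G.r γ)) (index f z.1) γ * coord (index f z.1) z)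

/-- The right action of the structure group. -/
noncomputable def act (z : f.BundleSpace) (t : S) : f.BundleSpace :=
  pt f (index f z.1) z.1 (coord (index f z.1) z * t)

/-- The element of `S` taking `z` to a point `w` of the same fibre; it is junk if the fibres are
different. -/
noncomputable def div (z w : f.BundleSpace) : S :=
  (coord (index f z.1) z)⁻¹ * coord (index f z.1) w

theorem τ_pt {a : B.J} {x : G.Obj} (ha : x ∈ B.U a) (t : S) :
    τ f (pt f a x t) = pt f (B.bar a) (G.ρ₀ x) (RealGroup.conj t) := by
  have hi := mem_index f x
  have hconj : f (B.bar (index f x)) (B.bar a) (G.unit (G.ρ₀ x)) =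
      RealGroup.conj (f (index f x) a (G.unit x)) := by
    rw [← G.ρ_unit, f.map_ρ (by rwa [G.r_unit]) (by rwa [G.s_unit])]
  rw [pt_eq_pt (B.mem_bar hi) (B.mem_bar ha), hconj, ← _root_.map_mul, ← coord_pt hi ha]
  rfl

theorem lact_pt {a b : B.J} {γ : G.Arr} {x : G.Obj} (hx : G.s γ = x) (ha : x ∈ B.U a)
    (hb : G.r γ ∈ B.U b) (t : S) : lact γ (pt f a x t) = pt f b (G.r γ) (f b a γ * t) := by
  subst hx
  have hi := mem_index f (G.s γ)
  have hj := mem_index f (G.r γ)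
  rw [pt_eq_pt hj hb, ← mul_assoc, f.map_unit_mul rfl hj hb ha, ← f.map_mul_unit rfl hj hi ha,
    mul_assoc, ← coord_pt hi ha]
  rfl

theorem act_pt {a : B.J} {x : G.Obj} (ha : x ∈ B.U a) (t t' : S) :
    act (pt f a x t) t' = pt f a x (t * t') := by
  rw [pt_eq_pt (mem_index f x) ha (t * t'), ← mul_assoc, ← coord_pt (mem_index f x) ha]
  rfl

theorem div_eq {a : B.J} {z w : f.BundleSpace} (h : z.1 = w.1) (ha : z.1 ∈ B.U a) :
    div z w = (coord a z)⁻¹ * coord a w := by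
  induction z using ind with | _ b x hb t
  induction w using ind with | _ d y hd t'
  obtain rfl : x = y := h
  have hi := mem_index f x
  have key (i) (hi : x ∈ B.U i) : (coord i (pt f b x t))⁻¹ * coord i (pt f d x t') =
      t⁻¹ * (f b d (G.unit x) * t') := by
    rw [coord_pt hi hb, coord_pt hi hd,
      ← f.map_unit_mul (G.r_unit x) hi hb (by rwa [G.s_unit] : G.s (G.unit x) ∈ B.U d)]
    group
  exact (key _ hi).trans (key a ha).symm

theorem act_div {z w : f.BundleSpace} (h : z.1 = w.1) : act z (div z w) = w := by
  rw [act, div, mul_inv_cancel_left]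
  have := pt_coord w (h ▸ mem_index f z.1)
  rwa [← h] at this

theorem div_act (z : f.BundleSpace) (t : S) : div z (act z t) = t := by
  have hi := mem_index f z.1
  rw [div, act, coord_pt hi hi, f.map_unit hi, one_mul, inv_mul_cancel_left]

theorem unit_lact (z : f.BundleSpace) : lact (G.unit z.1) z = z := by
  induction z using ind with | _ a x ha t
  refine (lact_pt (b := a) (G.s_unit x) ha (by rwa [G.r_unit]) t).trans ?_
  rw [f.map_unit ha, one_mul, G.r_unit]

theorem mul_lact {γ γ' : G.Arr} (z : f.BundleSpace) (e : G.s γ = G.r γ') (e' : G.s γ' = z.1) :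
    lact (G.mul γ γ' e) z = lact γ (lact γ' z) := by
  induction z using ind with | _ a x ha t
  obtain rfl : G.s γ' = x := e'
  have hj := mem_index f (G.r γ)
  have hi := mem_index f (G.r γ')
  rw [lact_pt rfl ha hi, lact_pt (G.s_mul _ _ _) ha (by rwa [G.r_mul]), lact_pt e hi hj,
    f.map_mul (b := index f (G.r γ')) e hj (by rwa [e]) ha, mul_assoc, G.r_mul]

theorem act_one (z : f.BundleSpace) : act z 1 = z := by
  induction z using ind with | _ a x ha t
  rw [act_pt ha, mul_one]

theorem act_mul (z : f.BundleSpace) (t t' : S) : act z (t * t') = act (act z t) t' := by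
  induction z using ind with | _ a x ha u
  rw [act_pt ha, act_pt ha, act_pt ha, mul_assoc]

theorem lact_act {γ : G.Arr} (z : f.BundleSpace) (t : S) (e : G.s γ = z.1) :
    lact γ (act z t) = act (lact γ z) t := by
  induction z using ind with | _ a x ha u
  obtain rfl : G.s γ = x := e
  have hj := mem_index f (G.r γ)
  rw [act_pt ha, lact_pt rfl ha hj, lact_pt rfl ha hj, act_pt hj, mul_assoc]

theorem τ_τ (z : f.BundleSpace) : τ f (τ f z) = z := by
  induction z using ind with | _ a x ha t
  rw [τ_pt ha, τ_pt (B.mem_bar ha), B.bar_bar, G.ρ₀_ρ₀, RealGroup.conj_conj]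

theorem τ_lact {γ : G.Arr} (z : f.BundleSpace) (e : G.s γ = z.1) :
    τ f (lact γ z) = lact (G.ρ γ) (τ f z) := by
  induction z using ind with | _ a x ha t
  obtain rfl : G.s γ = x := e
  have hj := mem_index f (G.r γ)
  rw [lact_pt rfl ha hj, τ_pt hj, τ_pt ha,
    lact_pt (G.s_ρ _) (B.mem_bar ha) (by rw [G.r_ρ]; exact B.mem_bar hj), f.map_ρ hj ha,
    _root_.map_mul, G.r_ρ]

theorem τ_act (z : f.BundleSpace) (t : S) : τ f (act z t) = act (τ f z) (RealGroup.conj t) := by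
  induction z using ind with | _ a x ha u
  rw [act_pt ha, τ_pt ha, τ_pt ha, _root_.map_mul, act_pt (B.mem_bar ha)]

theorem continuous_τ : Continuous (τ f) := by
  refine continuous_iff_continuousAt.2 fun z => ?_
  have hz := mem_index f z.1
  refine continuousAt_of_pt (a := B.bar (index f z.1))
    (G.continuous_ρ₀.comp continuous_proj).continuousAt
    (RealGroup.continuous_conj.continuousAt.comp (continuousAt_coord continuousAt_id hz))
    (B.mem_bar hz) ?_
  filter_upwards [eventually_mem continuousAt_id hz] with w hw
  exact (congrArg (τ f) (pt_coord w hw)).symm.trans (τ_pt hw _)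

theorem continuous_act : Continuous fun p : f.BundleSpace × S => act p.1 p.2 := by
  refine continuous_iff_continuousAt.2 fun ⟨z, t⟩ => ?_
  have hz := mem_index f z.1
  refine continuousAt_of_pt (continuous_proj.comp continuous_fst).continuousAt
    ((continuousAt_coord continuousAt_fst hz).mul continuousAt_snd) hz ?_
  filter_upwards [eventually_mem continuousAt_fst hz] with p hp
  exact (congrArg (act · p.2) (pt_coord p.1 hp)).symm.trans (act_pt hp _ _)

theorem continuous_lact : Continuous fun p : {p : G.Arr × f.BundleSpace // G.s p.1 = p.2.1} =>
    lact p.1.1 p.1.2 := by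
  refine continuous_iff_continuousAt.2 fun ⟨⟨γ, z⟩, (e : G.s γ = z.1)⟩ => ?_
  have hz := mem_index f z.1
  have hr := mem_index f (G.r γ)
  have hs : G.s γ ∈ B.U (index f z.1) := by rwa [e]
  have hf : ContinuousAt (f (index f (G.r γ)) (index f z.1)) γ :=
    (f.continuousOn _ _).continuousAt ((((B.isOpen_U _).preimage G.continuous_r).inter
      ((B.isOpen_U _).preimage G.continuous_s)).mem_nhds ⟨hr, hs⟩)
  let P := {p : G.Arr × f.BundleSpace // G.s p.1 = p.2.1}
  have h₁ : Continuous fun p : P => p.1.1 := by fun_prop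
  have h₂ : Continuous fun p : P => p.1.2 := by fun_prop
  refine continuousAt_of_pt (G.continuous_r.comp h₁).continuousAt
    ((ContinuousAt.comp (x := (⟨(γ, z), e⟩ : P)) (f := fun p : P => p.1.1) hf h₁.continuousAt).mul
      (continuousAt_coord h₂.continuousAt hz)) hr ?_
  filter_upwards [eventually_mem h₂.continuousAt hz,
    ((B.isOpen_U _).preimage (G.continuous_r.comp h₁)).mem_nhds hr] with p hp hp'
  exact (congrArg (lact p.1.1) (pt_coord p.1.2 hp)).symm.trans (lact_pt p.2 hp hp' _)

theorem continuous_div : Continuous fun q : {q : f.BundleSpace × f.BundleSpace // q.1.1 = q.2.1} =>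
    div q.1.1 q.1.2 := by
  refine continuous_iff_continuousAt.2 fun ⟨⟨z, w⟩, (e : z.1 = w.1)⟩ => ?_
  have hz := mem_index f z.1
  let Q := {q : f.BundleSpace × f.BundleSpace // q.1.1 = q.2.1}
  have h₁ : Continuous fun q : Q => q.1.1 := by fun_prop
  have h₂ : Continuous fun q : Q => q.1.2 := by fun_prop
  refine ((continuousAt_coord h₁.continuousAt hz).inv.mul
    (continuousAt_coord (a := index f z.1) (t₀ := (⟨(z, w), e⟩ : Q)) h₂.continuousAt
      (e ▸ hz : w.1 ∈ B.U (index f z.1)))).congr ?_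
  filter_upwards [eventually_mem h₁.continuousAt hz] with q hq using (div_eq q.2 hq).symm

instance : LocallyCompactSpace f.BundleSpace :=
  ChartedSpace.locallyCompactSpace (G.Obj × S) f.BundleSpace

instance : T2Space f.BundleSpace := t2Space_totalSpace

end BundleSpace

open BundleSpace

/-- The Real bibundle with the total space `BundleSpace f`. -/
noncomputable def bibundle : RealBibundle G (ofGroup S) where
  Z := f.BundleSpace
  τ := τ f
  continuous_τ := continuous_τ
  τ_τ := τ_τ
  rng z := z.1
  src _ := PUnit.unit
  continuous_rng := continuous_proj
  isOpenMap_rng := f.bundleCore.isOpenMap_proj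
  surjective_rng x := ⟨pt f (index f x) x 1, rfl⟩
  continuous_src := continuous_const
  isOpenMap_src _ _ := isOpen_discrete (α := PUnit) _
  rng_τ _ := rfl
  src_τ _ := rfl
  lact γ z _ := lact γ z
  ract z t _ := act z t
  continuous_lact := continuous_lact
  continuous_ract := continuous_act.comp continuous_subtype_val
  rng_lact _ _ _ := rfl
  src_lact _ _ _ := rfl
  src_ract _ _ _ := rfl
  rng_ract _ _ _ := rfl
  unit_lact := unit_lact
  ract_unit := act_one
  mul_lact _ _ z e e' := mul_lact z e e'
  ract_mul z t t' _ _ := act_mul z t t'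
  lact_ract _ z t e _ := lact_act z t e
  τ_lact _ z e := τ_lact z e
  τ_ract z t _ := τ_act z t

theorem isPrincipal_bibundle : f.bibundle.IsPrincipal := by
  refine RealBibundle.isPrincipal_of_div _ (fun y => ?_) (fun q => div q.1.1 q.1.2)
    continuous_div (fun q => act_div q.2) (fun q t h => ?_)
  · refine ⟨B.U (index f y), B.isOpen_U _, mem_index f y,
      ⟨fun x => pt f (index f y) x 1, ?_⟩, fun _ => rfl⟩
    exact (continuousOn_pt _).comp_continuous
      (f := fun x : B.U (index f y) => ((x : G.Obj), (1 : S))) (by fun_prop)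
      fun x => ⟨x.2, mem_univ _⟩
  · exact (congrArg (div q.1.1) h).symm.trans (div_act _ t)

/-- The Real generalized homomorphism glued along the cocycle `f`. -/
noncomputable def genHom : RealGenHom G (ofGroup S) where
  toRealBibundle := f.bibundle
  isPrincipal := f.isPrincipal_bibundle
  isLocallyTrivial := f.isPrincipal_bibundle.isLocallyTrivial

end ArrowCocycle

namespace RealCover

/-- The Real cover by the members of an open cover and their images under the involution; the
second component of an index tells whether the involution is applied. -/
def symmetrize {X ι : Type u} [TopologicalSpace X] {ρ : X → X} (hρ : Function.Involutive ρ)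
    (hρ' : Continuous ρ) (A : ι → Set X) (hA : ∀ i, IsOpen (A i)) (hA' : ∀ x, ∃ i, x ∈ A i) :
    RealCover X ρ where
  J := ι × Bool
  bar j := (j.1, !j.2)
  bar_bar j := Prod.ext rfl (Bool.not_not j.2)
  U j := bif j.2 then A j.1 else ρ ⁻¹' A j.1
  isOpen_U
    | (i, true) => hA i
    | (i, false) => (hA i).preimage hρ'
  exists_mem x := (hA' x).imp' (·, true) fun _ h => h
  U_bar j := by
    rw [image_eq_preimage_of_inverse hρ.leftInverse hρ.rightInverse]
    match j with
    | (i, true) => rfl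
    | (i, false) => exact ext fun x => show x ∈ A i ↔ ρ (ρ x) ∈ A i by rw [hρ x]

end RealCover

namespace RealBibundle

theorem lact_congr {Γ G : RealGroupoid.{u}} (Z : RealBibundle Γ G) {γ γ' : Γ.Arr} {z z' : Z.Z}
    (hγ : γ = γ') (hz : z = z') (e : Γ.s γ = Z.rng z) (e' : Γ.s γ' = Z.rng z') :
    Z.lact γ z e = Z.lact γ' z' e' := by
  subst hγ hz; rfl

end RealBibundle

namespace RealGenHom

open RealGroupoid (ofGroup)

variable {G : RealGroupoid.{u}} {S : Type u} [Group S] [TopologicalSpace S] [RealGroup S]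
  (Z : RealGenHom G (ofGroup S))

open Classical in
/-- The element of `S` taking `z` to a point `w` of the same fibre; it is `1` if the fibres are
different. -/
noncomputable def div (z w : Z.Z) : S :=
  if h : Z.rng z = Z.rng w then Z.isPrincipal.exists_divS.choose ⟨(z, w), h⟩ else 1

variable {Z}

theorem act_div {z w : Z.Z} (h : Z.rng z = Z.rng w) : Z.act z (Z.div z w) = w := by
  rw [div, dif_pos h]
  exact Z.isPrincipal.exists_divS.choose_spec.2.1 ⟨(z, w), h⟩

theorem div_act (z : Z.Z) (t : S) : Z.div z (Z.act z t) = t := by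
  rw [div, dif_pos (Z.rng_act z t).symm]
  exact Z.isPrincipal.exists_divS.choose_spec.2.2 _ t rfl

theorem act_injective (z : Z.Z) : Function.Injective (Z.act z) :=
  Function.LeftInverse.injective (div_act z)

theorem continuousOn_div :
    ContinuousOn (fun q : Z.Z × Z.Z => Z.div q.1 q.2) {q | Z.rng q.1 = Z.rng q.2} := by
  rw [continuousOn_iff_continuous_domRestrict]
  refine Z.isPrincipal.exists_divS.choose_spec.1.congr fun q => ?_
  rw [domRestrict_apply, div, dif_pos q.2]

variable (Z) in
/-- An extension to all units of a local section of `rng`; it is continuous only on the domain of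
the section. -/
noncomputable def extendSection {A : Set G.Obj} (s : A → Z.Z) : G.Obj → Z.Z :=
  Function.extend Subtype.val s (Function.surjInv Z.surjective_rng)

theorem extendSection_apply {A : Set G.Obj} (s : A → Z.Z) (x : A) : Z.extendSection s x = s x :=
  Subtype.val_injective.extend_apply s _ x

theorem rng_extendSection {A : Set G.Obj} {s : A → Z.Z} (hs : ∀ x, Z.rng (s x) = x) (x : G.Obj) :
    Z.rng (Z.extendSection s x) = x := by
  by_cases h : x ∈ A
  · exact (congrArg Z.rng (extendSection_apply s ⟨x, h⟩)).trans (hs ⟨x, h⟩)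
  · rw [extendSection, Function.extend_apply' _ _ _ fun ⟨y, hy⟩ => h (hy ▸ y.2)]
    exact Function.surjInv_eq Z.surjective_rng x

theorem continuousOn_extendSection {A : Set G.Obj} {s : A → Z.Z} (hs : Continuous s) :
    ContinuousOn (Z.extendSection s) A := by
  rw [continuousOn_iff_continuous_domRestrict]
  exact hs.congr fun x => (extendSection_apply s x).symm

variable (Z)

/-- A Real family of local sections of `rng : Z → X`, continuous on the members of a Real cover.
Outside of the member `B.U a` the section `toFun a` is arbitrary. -/
structure RealSections (B : RealCover G.Obj G.ρ₀) where
  toFun : B.J → G.Obj → Z.Z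
  continuousOn : ∀ a, ContinuousOn (toFun a) (B.U a)
  rng_apply : ∀ a x, Z.rng (toFun a x) = x
  map_ρ : ∀ {a x}, x ∈ B.U a → toFun (B.bar a) (G.ρ₀ x) = Z.τ (toFun a x)

theorem exists_realSections : ∃ B : RealCover G.Obj G.ρ₀, Nonempty (Z.RealSections B) := by
  choose A hA hy s hs using Z.isPrincipal.1
  refine ⟨.symmetrize G.ρ₀_ρ₀ G.continuous_ρ₀ A hA fun x => ⟨x, hy x⟩, ⟨{
    toFun := fun
      | (y, true), x => Z.extendSection (s y) x
      | (y, false), x => Z.τ (Z.extendSection (s y) (G.ρ₀ x))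
    continuousOn := fun
      | (y, true) => continuousOn_extendSection (s y).continuous
      | (y, false) => Z.continuous_τ.comp_continuousOn
        ((continuousOn_extendSection (s y).continuous).comp G.continuous_ρ₀.continuousOn
          fun _ h => h)
    rng_apply := fun
      | (y, true), x => rng_extendSection (hs y) x
      | (y, false), x => by rw [Z.rng_τ, rng_extendSection (hs y), G.ρ₀_ρ₀]
    map_ρ := fun {a x} _ =>
      match a with
      | (y, true) => congrArg (fun x => Z.τ (Z.extendSection (s y) x)) (G.ρ₀_ρ₀ x)
      | (y, false) => (Z.τ_τ _).symm }⟩⟩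

namespace RealSections

variable {Z} {Z' : RealGenHom G (ofGroup S)} {B B' : RealCover G.Obj G.ρ₀}

instance : CoeFun (Z.RealSections B) fun _ => B.J → G.Obj → Z.Z :=
  ⟨toFun⟩

/-- The restriction of a Real family of sections to a refinement of the cover. -/
def comap (σ : Z.RealSections B) (θ : B'.J → B.J) (hbar : ∀ a, θ (B'.bar a) = B.bar (θ a))
    (hsub : ∀ a, B'.U a ⊆ B.U (θ a)) : Z.RealSections B' where
  toFun a := σ (θ a)
  continuousOn a := (σ.continuousOn (θ a)).mono (hsub a)
  rng_apply a := σ.rng_apply (θ a)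
  map_ρ hx := (congrFun (congrArg σ.toFun (hbar _)) _).trans (σ.map_ρ (hsub _ hx))

variable (σ : Z.RealSections B) (σ' : Z'.RealSections B)

theorem ind {C : Z.Z → Prop} (h : ∀ a x (_ : x ∈ B.U a) t, C (Z.act (σ a x) t)) (z : Z.Z) :
    C z := by
  obtain ⟨a, ha⟩ := B.exists_mem (Z.rng z)
  exact act_div (σ.rng_apply a (Z.rng z)) ▸ h a _ ha _

/-- The translate `γ · σ b (s γ)` of a section. -/
def translate (b : B.J) (γ : G.Arr) : Z.Z :=
  Z.lact γ (σ b (G.s γ)) (σ.rng_apply b _).symm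

theorem lact_eq_translate {b : B.J} {γ : G.Arr} {x : G.Obj} (hx : G.s γ = x)
    (e : G.s γ = Z.rng (σ b x)) : Z.lact γ (σ b x) e = σ.translate b γ := by
  subst hx; rfl

theorem rng_translate (b : B.J) (γ : G.Arr) : Z.rng (σ.translate b γ) = G.r γ :=
  Z.rng_lact _ _ _

theorem translate_unit (b : B.J) (x : G.Obj) : σ.translate b (G.unit x) = σ b x := by
  rw [← σ.lact_eq_translate (G.s_unit x) ((G.s_unit x).trans (σ.rng_apply b x).symm)]
  exact (Z.lact_congr (congrArg G.unit (σ.rng_apply b x).symm) rfl _ _).trans (Z.unit_lact _)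

theorem translate_mul (b : B.J) {γ γ' : G.Arr} (e : G.s γ = G.r γ') :
    σ.translate b (G.mul γ γ' e) =
      Z.lact γ (σ.translate b γ') (e.trans (σ.rng_translate b γ').symm) := by
  have hs := G.s_mul γ γ' e
  rw [← σ.lact_eq_translate hs (hs.trans (σ.rng_apply b _).symm)]
  exact Z.mul_lact _ _ _ e _

theorem τ_translate {b : B.J} {γ : G.Arr} (hb : G.s γ ∈ B.U b) :
    Z.τ (σ.translate b γ) = σ.translate (B.bar b) (G.ρ γ) := by
  refine (Z.τ_lact _ _ _).trans (Z.lact_congr rfl ?_ _ _)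
  rw [G.s_ρ, σ.map_ρ hb]

theorem continuousOn_translate (b : B.J) :
    ContinuousOn (σ.translate b) (G.s ⁻¹' B.U b) := by
  rw [continuousOn_iff_continuous_domRestrict]
  have hσ : Continuous fun γ : G.s ⁻¹' B.U b => σ b (G.s γ) :=
    (σ.continuousOn b).comp_continuous (G.continuous_s.comp continuous_subtype_val) Subtype.property
  exact Z.continuous_lact.comp
    ((continuous_subtype_val.prodMk hσ).subtype_mk fun γ => (σ.rng_apply b (G.s γ)).symm)

/-- `f` is the transition cocycle of the sections `σ`. -/
def HasCocycle (f : ArrowCocycle B S) : Prop :=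
  ∀ ⦃a b γ⦄, G.r γ ∈ B.U a → G.s γ ∈ B.U b → σ.translate b γ = Z.act (σ a (G.r γ)) (f a b γ)

theorem act_div_translate (a b : B.J) (γ : G.Arr) :
    Z.act (σ a (G.r γ)) (Z.div (σ a (G.r γ)) (σ.translate b γ)) = σ.translate b γ :=
  act_div ((σ.rng_apply _ _).trans (σ.rng_translate _ _).symm)

/-- The transition cocycle of a Real family of sections. -/
noncomputable def cocycle : ArrowCocycle B S where
  toFun a b γ := Z.div (σ a (G.r γ)) (σ.translate b γ)
  continuousOn a b :=
    continuousOn_div.comp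
      (f := fun γ => (σ a (G.r γ), σ.translate b γ))
      (((σ.continuousOn a).comp G.continuous_r.continuousOn fun _ h => h.1).prodMk
        ((σ.continuousOn_translate b).mono fun _ h => h.2))
      fun γ _ => (σ.rng_apply a _).trans (σ.rng_translate b γ).symm
  map_mul {a b d γ γ'} e _ _ _ := by
    refine act_injective (σ a (G.r γ)) ?_
    have hmul := σ.act_div_translate a d (G.mul γ γ' e)
    rw [G.r_mul] at hmul ⊢
    rw [hmul, ← Z.act_act, act_div_translate, translate_mul]
    refine (Z.lact_congr rfl ?_ _ _).trans (Z.lact_act γ (σ b (G.s γ)) _ ?_ _)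
    · rw [e, act_div_translate]
    · rw [Z.rng_act, σ.rng_apply]
  map_ρ {a b γ} ha hb := by
    rw [G.r_ρ, σ.map_ρ ha, ← σ.τ_translate hb, ← σ.act_div_translate a b γ, Z.τ_act, div_act,
      div_act]

theorem hasCocycle_cocycle : σ.HasCocycle σ.cocycle :=
  fun a b γ _ _ => (σ.act_div_translate a b γ).symm

variable {σ σ'} {f : ArrowCocycle B S}

theorem HasCocycle.apply_eq_act (hσ : σ.HasCocycle f) {a b : B.J} {x : G.Obj} (ha : x ∈ B.U a)
    (hb : x ∈ B.U b) : σ b x = Z.act (σ a x) (f a b (G.unit x)) := by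
  rw [← σ.translate_unit b x, hσ (a := a) (by rwa [G.r_unit]) (by rwa [G.s_unit]), G.r_unit]

theorem HasCocycle.div_eq_mul (hσ : σ.HasCocycle f) {a b : B.J} {z : Z.Z} (ha : Z.rng z ∈ B.U a)
    (hb : Z.rng z ∈ B.U b) : Z.div (σ a (Z.rng z)) z =
      f a b (G.unit (Z.rng z)) * Z.div (σ b (Z.rng z)) z := by
  refine act_injective (σ a (Z.rng z)) ?_
  rw [act_div (σ.rng_apply _ _), ← Z.act_act, ← hσ.apply_eq_act ha hb, act_div (σ.rng_apply _ _)]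

/-- The map `σ a x · t ↦ σ' a x · t`. It does not depend on the choice of `a` if the two families of
sections have the same transition cocycle. -/
noncomputable def compare (σ : Z.RealSections B) (σ' : Z'.RealSections B) (z : Z.Z) : Z'.Z :=
  let a := (B.exists_mem (Z.rng z)).choose
  Z'.act (σ' a (Z.rng z)) (Z.div (σ a (Z.rng z)) z)

theorem HasCocycle.compare_eq (hσ : σ.HasCocycle f) (hσ' : σ'.HasCocycle f) {a : B.J} {z : Z.Z}
    (ha : Z.rng z ∈ B.U a) :
    compare σ σ' z = Z'.act (σ' a (Z.rng z)) (Z.div (σ a (Z.rng z)) z) := by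
  have hi := (B.exists_mem (Z.rng z)).choose_spec
  rw [compare, hσ.div_eq_mul hi ha, ← Z'.act_act, ← hσ'.apply_eq_act hi ha]

theorem HasCocycle.compare_act (hσ : σ.HasCocycle f) (hσ' : σ'.HasCocycle f) {a : B.J} {x : G.Obj}
    (ha : x ∈ B.U a) (t : S) : compare σ σ' (Z.act (σ a x) t) = Z'.act (σ' a x) t := by
  have hx : Z.rng (Z.act (σ a x) t) = x := (Z.rng_act _ _).trans (σ.rng_apply a x)
  rw [hσ.compare_eq hσ' (by rwa [hx]), hx, div_act]

theorem HasCocycle.continuous_compare (hσ : σ.HasCocycle f) (hσ' : σ'.HasCocycle f) :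
    Continuous (compare σ σ') := by
  refine continuous_iff_continuousAt.2 fun z => ?_
  obtain ⟨a, ha⟩ := B.exists_mem (Z.rng z)
  have hU : Z.rng ⁻¹' B.U a ∈ 𝓝 z := ((B.isOpen_U a).preimage Z.continuous_rng).mem_nhds ha
  refine ContinuousOn.continuousAt (ContinuousOn.congr ?_ fun w hw => hσ.compare_eq hσ' hw) hU
  have hsec : ContinuousOn (fun w => σ a (Z.rng w)) (Z.rng ⁻¹' B.U a) :=
    (σ.continuousOn a).comp Z.continuous_rng.continuousOn fun _ h => h
  have hsec' : ContinuousOn (fun w => σ' a (Z.rng w)) (Z.rng ⁻¹' B.U a) :=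
    (σ'.continuousOn a).comp Z.continuous_rng.continuousOn fun _ h => h
  exact Z'.continuous_act.comp_continuousOn (hsec'.prodMk
    (continuousOn_div.comp (hsec.prodMk continuousOn_id) fun w _ => σ.rng_apply a (Z.rng w)))

theorem HasCocycle.rng_compare (hσ : σ.HasCocycle f) (hσ' : σ'.HasCocycle f) :
    ∀ z, Z'.rng (compare σ σ' z) = Z.rng z :=
  σ.ind fun a x ha t => by
    rw [hσ.compare_act hσ' ha, Z'.rng_act, Z.rng_act, σ.rng_apply, σ'.rng_apply]

theorem HasCocycle.compare_τ (hσ : σ.HasCocycle f) (hσ' : σ'.HasCocycle f) :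
    ∀ z, compare σ σ' (Z.τ z) = Z'.τ (compare σ σ' z) :=
  σ.ind fun a x ha t => by
    rw [Z.τ_act, ← σ.map_ρ ha, hσ.compare_act hσ' (B.mem_bar ha), hσ.compare_act hσ' ha, Z'.τ_act,
      σ'.map_ρ ha]

theorem HasCocycle.lact_act_eq (hσ : σ.HasCocycle f) {a b : B.J} {γ : G.Arr}
    (ha : G.r γ ∈ B.U a) (hb : G.s γ ∈ B.U b) (t : S) (e : G.s γ = Z.rng (Z.act (σ b (G.s γ)) t)) :
    Z.lact γ (Z.act (σ b (G.s γ)) t) e = Z.act (σ a (G.r γ)) (f a b γ * t) := by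
  rw [← Z.act_act, ← hσ ha hb]
  exact Z.lact_act _ _ _ _ _

theorem HasCocycle.compare_lact (hσ : σ.HasCocycle f) (hσ' : σ'.HasCocycle f) (γ : G.Arr) :
    ∀ z e, compare σ σ' (Z.lact γ z e) =
      Z'.lact γ (compare σ σ' z) (e.trans (hσ.rng_compare hσ' z).symm) :=
  σ.ind fun b x hb t e => by
    obtain rfl : G.s γ = x := e.trans ((Z.rng_act _ _).trans (σ.rng_apply b x))
    obtain ⟨a, ha⟩ := B.exists_mem (G.r γ)
    have hc := hσ.compare_act hσ' hb t
    rw [hσ.lact_act_eq ha hb, hσ.compare_act hσ' ha, ← hσ'.lact_act_eq ha hb t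
      (((Z'.rng_act _ _).trans (σ'.rng_apply _ _)).symm)]
    exact Z'.lact_congr rfl hc.symm _ _

theorem HasCocycle.compare_ract (hσ : σ.HasCocycle f) (hσ' : σ'.HasCocycle f) (t' : S) :
    ∀ z, compare σ σ' (Z.act z t') = Z'.act (compare σ σ' z) t' :=
  σ.ind fun a x ha t => by
    rw [Z.act_act, hσ.compare_act hσ' ha, hσ.compare_act hσ' ha, Z'.act_act]

theorem HasCocycle.compare_compare (hσ : σ.HasCocycle f) (hσ' : σ'.HasCocycle f) :
    Function.LeftInverse (compare σ' σ) (compare σ σ') :=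
  σ.ind fun a x ha t => by rw [hσ.compare_act hσ' ha, hσ'.compare_act hσ ha]

theorem HasCocycle.nonempty_iso (hσ : σ.HasCocycle f) (hσ' : σ'.HasCocycle f) :
    Nonempty (Iso Z Z') :=
  ⟨{
    f := ⟨⟨compare σ σ', compare σ' σ, hσ.compare_compare hσ', hσ'.compare_compare hσ⟩,
      hσ.continuous_compare hσ', hσ'.continuous_compare hσ⟩
    rng_f := hσ.rng_compare hσ'
    src_f := fun _ => rfl
    τ_f := hσ.compare_τ hσ'
    f_lact := fun γ z e => hσ.compare_lact hσ' γ z e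
    f_ract := fun z t _ => hσ.compare_ract hσ' t z }⟩

end RealSections

end RealGenHom

namespace ArrowCocycle

variable {G : RealGroupoid.{u}} {S : Type u} [Group S] [TopologicalSpace S] [RealGroup S]
  {B : RealCover G.Obj G.ρ₀} (f : ArrowCocycle B S)

/-- The sections of the bundle of a cocycle that correspond to `1` in the local trivializations. -/
noncomputable def sections : f.genHom.RealSections B where
  toFun a x := BundleSpace.pt f a x 1
  continuousOn a := (BundleSpace.continuousOn_pt a).comp
    (f := fun x => (x, (1 : S))) (by fun_prop) fun _ hx => ⟨hx, mem_univ _⟩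
  rng_apply _ _ := rfl
  map_ρ {a x} ha := ((BundleSpace.τ_pt ha 1).trans
    (congrArg (BundleSpace.pt f (B.bar a) (G.ρ₀ x)) (map_one _))).symm

theorem hasCocycle_sections : f.sections.HasCocycle f := fun a b γ ha hb =>
  (BundleSpace.lact_pt rfl hb ha 1).trans <| by
    refine Eq.trans ?_ (BundleSpace.act_pt ha 1 _).symm
    rw [one_mul, mul_one]

end ArrowCocycle

namespace NerveCover

variable {G : RealGroupoid.{u}} {U : NerveCover G}

/-- The cover of the nerve by the strings whose vertices lie in prescribed members of a Real cover
of the units. -/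
def ofBaseCover (B : RealCover G.Obj G.ρ₀) : NerveCover G := fun n =>
  { J := Fin (n + 1) → B.J
    bar := fun j i => B.bar (j i)
    bar_bar := fun j => funext fun i => B.bar_bar (j i)
    U := fun j => {x | ∀ i, x.obj i ∈ B.U (j i)}
    isOpen_U := fun j => by
      rw [ofPred_forall]
      exact isOpen_iInter_of_finite fun i => (B.isOpen_U (j i)).preimage (Nerve.continuous_obj i)
    exists_mem := fun x => Classical.skolem.1 fun i => B.exists_mem (x.obj i)
    U_bar := fun j => by
      rw [image_eq_preimage_of_inverse Nerve.ρ_ρ Nerve.ρ_ρ]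
      ext x
      exact forall_congr' fun i => by rw [B.U_bar_eq_preimage G.ρ₀_ρ₀]; rfl }

theorem hasSimplicialStructure_ofBaseCover (B : RealCover G.Obj G.ρ₀) (N : ℕ) :
    (ofBaseCover B).HasSimplicialStructure N :=
  ⟨fun _ _ f j i => j (f i), fun _ _ => rfl, fun _ _ _ _ _ _ => rfl, fun _ _ _ _ => rfl,
    fun _ _ f _ _ hx i => hx (f i)⟩

/-- The index of `♮U` in degree `0` with the vertex `a`. -/
def vertexIndex (a : U.baseCover.J) : (U.nat.cov 0).J
  | 0, _ => a
  | k + 1, φ => (k.not_succ_le_zero (le_of_orderEmbedding φ)).elim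

theorem eq_vertexIndex {l : (U.nat.cov 0).J} {a : U.baseCover.J} (h : vertex l 0 = a) :
    l = vertexIndex a :=
  index_ext_zero h

theorem ofObj_mem_vertexIndex {a : U.baseCover.J} {x : G.Obj} (h : x ∈ U.baseCover.U a) :
    Nerve.ofObj x ∈ (U.nat.cov 0).U (vertexIndex a)
  | 0, φ => by
    change Nerve.face φ (Nerve.ofObj x) ∈ (U 0).U a
    rwa [Nerve.face_eq_ofObj, Fin.fin_one_eq_zero (φ 0), Nerve.obj_ofObj]
  | k + 1, φ => (k.not_succ_le_zero (le_of_orderEmbedding φ)).elim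

end NerveCover

theorem PreSimplicialCover.section_congr {X Y ι : Type*} {A : ι → Set X} (s : ∀ j, A j → Y)
    {j j' : ι} {x x' : X} (hj : j = j') (hx : x = x') (h : x ∈ A j) (h' : x' ∈ A j') :
    s j ⟨x, h⟩ = s j' ⟨x', h'⟩ := by
  subst hj hx; rfl

namespace RealGenHom

open PreSimplicialCover (ε)
open RealGroupoid (ofGroup)
open NerveCover

variable {G : RealGroupoid.{u}} {S : Type u} [Group S] [TopologicalSpace S] [RealGroup S]
  {Z Z' : RealGenHom G (ofGroup S)} {U : NerveCover G}

namespace RealSections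

variable {σ : Z.RealSections U.baseCover} {f : ArrowCocycle U.baseCover S}

/-- The sections over the members of `♮U` in degree `0`. -/
def nat (σ : Z.RealSections U.baseCover) (l : (U.nat.cov 0).J) : C((U.nat.cov 0).U l, Z.Z) where
  toFun x := σ (vertex l 0) (x.1.obj 0)
  continuous_toFun := (σ.continuousOn (vertex l 0)).comp_continuous
    ((Nerve.continuous_obj 0).comp continuous_subtype_val) fun x => vertex_mem x.2 0

theorem HasCocycle.isTransition (hσ : σ.HasCocycle f) : Z.IsTransition U.nat σ.nat f.nat where
  rng_s _ _ := σ.rng_apply _ _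
  s_bar _ _ hx := σ.map_ρ (vertex_mem hx 0)
  lact_s l x hx e := (σ.lact_eq_translate (x.s_arr 0 1) e).trans <|
    (hσ (r_arr_mem hx 0 1) (s_arr_mem hx 0 1)).trans <|
      congrArg (fun y => Z.act (σ (vertex l 0) y) _) (x.r_arr 0 1)

end RealSections

variable (Z) in
theorem exists_isTransition :
    ∃ (U : NerveCover.Adm G) (s : _) (c : _), Z.IsTransition U.cov.nat s c := by
  obtain ⟨B, ⟨σ⟩⟩ := Z.exists_realSections
  let σ' : Z.RealSections (ofBaseCover B).baseCover :=
    σ.comap (fun a => a 0) (fun _ => rfl) fun a x hx => Nerve.obj_ofObj x ▸ hx 0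
  exact ⟨⟨ofBaseCover B, 2, le_rfl, hasSimplicialStructure_ofBaseCover B 2⟩, _, _,
    σ'.hasCocycle_cocycle.isTransition⟩

theorem exists_isTransition_genHom (c : U.nat.ZR1 S) :
    ∃ s, (arrowCocycle c).genHom.IsTransition U.nat s c := by
  have h := (arrowCocycle c).hasCocycle_sections.isTransition
  rw [nat_arrowCocycle] at h
  exact ⟨_, h⟩

namespace IsTransition

theorem s_arr_eq {V : PreSimplicialCover G}
    {s : ∀ j : (V.cov 0).J, C((V.cov 0).U j, Z.Z)} {c : V.ZR1 S} (H : Z.IsTransition V s c)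
    {j : (V.cov 1).J} {x : Nerve G 1} (hx : x ∈ (V.cov 1).U j) :
    G.s (x.arr 0 1) = Z.rng (s _ ⟨_, V.face_mem (ε 0) j x hx⟩) :=
  (x.s_arr 0 1).trans (H.rng_s _ ⟨_, V.face_mem (ε 0) j x hx⟩).symm

variable {s : ∀ l : (U.nat.cov 0).J, C((U.nat.cov 0).U l, Z.Z)}
  {s' : ∀ l : (U.nat.cov 0).J, C((U.nat.cov 0).U l, Z'.Z)} {c : U.nat.ZR1 S}

/-- The section over a member of the cover of the units that is given by sections over `♮U`. -/
def vertexSection (s : ∀ l : (U.nat.cov 0).J, C((U.nat.cov 0).U l, Z.Z)) (a : U.baseCover.J) :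
    C(U.baseCover.U a, Z.Z) where
  toFun x := s (vertexIndex a) ⟨Nerve.ofObj x, ofObj_mem_vertexIndex x.2⟩
  continuous_toFun := (s (vertexIndex a)).continuous.comp <|
    (Nerve.continuous_ofObj.comp continuous_subtype_val).subtype_mk _

/-- The sections over the cover of the units that are given by sections over `♮U`. -/
noncomputable def realSections (H : Z.IsTransition U.nat s c) : Z.RealSections U.baseCover where
  toFun a := Z.extendSection (vertexSection s a)
  continuousOn a := continuousOn_extendSection (vertexSection s a).continuous
  rng_apply a := rng_extendSection fun x => (H.rng_s _ _).trans (Nerve.obj_ofObj x.1)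
  map_ρ {a x} hx := by
    have hbar : vertexSection s (U.baseCover.bar a) ⟨G.ρ₀ x, U.baseCover.mem_bar hx⟩ =
        Z.τ (vertexSection s a ⟨x, hx⟩) :=
      (PreSimplicialCover.section_congr (fun l => s l) (eq_vertexIndex rfl).symm
        (Nerve.ρ_ofObj x).symm _ _).trans (H.s_bar _ _ (ofObj_mem_vertexIndex hx))
    exact (extendSection_apply _ ⟨_, U.baseCover.mem_bar hx⟩).trans <|
      hbar.trans (congrArg Z.τ (extendSection_apply (vertexSection s a) ⟨x, hx⟩).symm)

theorem realSections_apply (H : Z.IsTransition U.nat s c) {l : (U.nat.cov 0).J} {x : Nerve G 0}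
    (hx : x ∈ (U.nat.cov 0).U l) : H.realSections (vertex l 0) (x.obj 0) = s l ⟨x, hx⟩ :=
  (extendSection_apply (vertexSection s _) ⟨_, vertex_mem hx 0⟩).trans <|
    PreSimplicialCover.section_congr (fun l => s l) (eq_vertexIndex rfl).symm
      (Nerve.ofObj_obj x) _ _

theorem translate_realSections (H : Z.IsTransition U.nat s c) {l : (U.nat.cov 1).J} {x : Nerve G 1}
    (hx : x ∈ (U.nat.cov 1).U l) : H.realSections.translate (vertex l 1) (x.arr 0 1) =
      Z.act (H.realSections (vertex l 0) (G.r (x.arr 0 1))) (c.1.1 l ⟨x, hx⟩) := by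
  have h0 := H.realSections_apply (U.nat.face_mem (ε 0) l x hx)
  have h1 := H.realSections_apply (U.nat.face_mem (ε 1) l x hx)
  rw [x.r_arr]
  refine Eq.trans ?_ ((H.lact_s l x hx (H.s_arr_eq hx)).trans (congrArg (Z.act · _) h1.symm))
  exact Z.lact_congr rfl ((congrArg _ (x.s_arr 0 1)).trans h0) _ _

theorem hasCocycle_realSections (H : Z.IsTransition U.nat s c) :
    H.realSections.HasCocycle (arrowCocycle c) := fun a b γ ha hb => by
  obtain ⟨l, hl, hv⟩ := exists_index_of_arr ha hb
  have h := H.translate_realSections hl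
  rw [hv, Nerve.arr_ofArr, ← arrowValue_eq c hl hv] at h
  exact h

theorem nonempty_iso (H : Z.IsTransition U.nat s c) (H' : Z'.IsTransition U.nat s' c) :
    Nonempty (Iso Z Z') :=
  H.hasCocycle_realSections.nonempty_iso H'.hasCocycle_realSections

end IsTransition

end RealGenHom

namespace RealGenHom

open PreSimplicialCover (ε)
open RealGroupoid (ofGroup)

section Group

variable {G : RealGroupoid.{u}} {S : Type u} [Group S] [TopologicalSpace S] [RealGroup S]
  {Z Z' : RealGenHom G (ofGroup S)}

namespace IsTransition

variable {V W : PreSimplicialCover G} {s s₁ : ∀ j : (V.cov 0).J, C((V.cov 0).U j, Z.Z)}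
  {c c₁ : V.ZR1 S}

theorem refine (H : Z.IsTransition V s c) (θ : PreSimplicialCover.Refinement W V) :
    Z.IsTransition W (fun i => (s (θ.θ 0 i)).comp (ContinuousMap.inclusion (θ.subset 0 i)))
      (θ.cocycle c) where
  rng_s _ _ := H.rng_s _ _
  s_bar i x hx := (PreSimplicialCover.section_congr (fun j => s j) (θ.θ_bar 0 i) rfl _ _).trans
    (H.s_bar _ x (θ.subset 0 i hx))
  lact_s i x hx e := by
    have hs (f : Fin (0 + 1) ↪o Fin (1 + 1)) :
        s (θ.θ 0 (W.face f i)) ⟨_, θ.subset 0 _ (W.face_mem f i x hx)⟩ =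
          s (V.face f (θ.θ 1 i)) ⟨_, V.face_mem f _ x (θ.subset 1 i hx)⟩ :=
      PreSimplicialCover.section_congr (fun j => s j) (θ.θ_face f i) rfl _ _
    exact (Z.lact_congr rfl (hs (ε 0)) e (H.s_arr_eq (θ.subset 1 i hx))).trans <|
      (H.lact_s _ x (θ.subset 1 i hx) _).trans (congrArg (Z.act · _) (hs (ε 1)).symm)

theorem map (H : Z.IsTransition V s c) (i : Iso Z Z') :
    Z'.IsTransition V (fun j => (i.f : C(Z.Z, Z'.Z)).comp (s j)) c where
  rng_s j x := (i.rng_f _).trans (H.rng_s j x)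
  s_bar j x hx := (congrArg i.f (H.s_bar j x hx)).trans (i.τ_f _)
  lact_s j x hx e := (i.f_lact _ _ (e.trans (i.rng_f _))).symm.trans <|
    (congrArg i.f (H.lact_s j x hx _)).trans (i.f_ract _ _ rfl)

theorem exists_of_equiv (H : Z.IsTransition V s c) (h : c ≈ c₁) :
    ∃ s₁, Z.IsTransition V s₁ c₁ := by
  obtain ⟨φ, h⟩ := h
  refine ⟨fun j => ⟨fun x => Z.act (s j x) (φ.1 j x), Z.continuous_act.comp
    ((s j).continuous.prodMk (φ.1 j).continuous)⟩, ?_, fun j x hx => ?_, fun j x hx e => ?_⟩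
  · exact fun j x => (Z.rng_act _ _).trans (H.rng_s j x)
  · change Z.act (s _ _) (φ.1 _ _) = Z.τ (Z.act (s _ _) (φ.1 _ _))
    rw [H.s_bar j x hx, φ.2 j x hx, Z.τ_act]
  · have hc : V.res φ.1 (ε 1) j ⟨x, hx⟩ * c₁.1.1 j ⟨x, hx⟩ =
        c.1.1 j ⟨x, hx⟩ * V.res φ.1 (ε 0) j ⟨x, hx⟩ := by
      rw [h j, mul_assoc]
      exact mul_inv_cancel_left _ _
    change Z.lact _ (Z.act _ _) _ = Z.act (Z.act _ _) _
    rw [Z.lact_act _ _ _ _ (e.trans (Z.rng_act _ _)), H.lact_s j x hx, Z.act_act, Z.act_act]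
    exact congrArg (Z.act _) hc.symm

/-- The Real `0`-cochain that carries one family of Real sections to another. -/
noncomputable def divCochain (H : Z.IsTransition V s c) (H₁ : Z.IsTransition V s₁ c₁) :
    V.CR S 0 :=
  ⟨fun j => ⟨fun x => Z.div (s j x) (s₁ j x), continuousOn_div.comp_continuous
      ((s j).continuous.prodMk (s₁ j).continuous)
      fun x => (H.rng_s j x).trans (H₁.rng_s j x).symm⟩,
    fun j x hx => by
      change Z.div (s _ _) (s₁ _ _) = RealGroup.conj (Z.div (s _ _) (s₁ _ _))
      have h := act_div ((H.rng_s j ⟨x, hx⟩).trans (H₁.rng_s j ⟨x, hx⟩).symm)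
      rw [H.s_bar j x hx, H₁.s_bar j x hx, ← congrArg Z.τ h, Z.τ_act, div_act]⟩

theorem act_divCochain (H : Z.IsTransition V s c) (H₁ : Z.IsTransition V s₁ c₁) (j : (V.cov 0).J)
    (x : (V.cov 0).U j) : Z.act (s j x) ((H.divCochain H₁).1 j x) = s₁ j x :=
  act_div ((H.rng_s j x).trans (H₁.rng_s j x).symm)

theorem equiv (H : Z.IsTransition V s c) (H₁ : Z.IsTransition V s₁ c₁) : c ≈ c₁ := by
  refine ⟨H.divCochain H₁, fun j => ContinuousMap.ext fun ⟨x, hx⟩ => ?_⟩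
  have h0 := H.act_divCochain H₁ _ ⟨_, V.face_mem (ε 0) j x hx⟩
  have h1 := H.act_divCochain H₁ _ ⟨_, V.face_mem (ε 1) j x hx⟩
  have hc : V.res (H.divCochain H₁).1 (ε 1) j ⟨x, hx⟩ * c₁.1.1 j ⟨x, hx⟩ =
      c.1.1 j ⟨x, hx⟩ * V.res (H.divCochain H₁).1 (ε 0) j ⟨x, hx⟩ := by
    refine Z.act_injective (s _ ⟨_, V.face_mem (ε 1) j x hx⟩) ?_
    calc Z.act _ (_ * c₁.1.1 j ⟨x, hx⟩)
      _ = Z.act (s₁ _ ⟨_, V.face_mem (ε 1) j x hx⟩) (c₁.1.1 j ⟨x, hx⟩) :=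
        (Z.act_act _ _ _).symm.trans (congrArg (Z.act · _) h1)
      _ = Z.lact (x.arr 0 1) (s₁ _ ⟨_, V.face_mem (ε 0) j x hx⟩) (H₁.s_arr_eq hx) :=
        (H₁.lact_s j x hx _).symm
      _ = Z.lact (x.arr 0 1) (Z.act (s _ ⟨_, V.face_mem (ε 0) j x hx⟩) _) _ :=
        Z.lact_congr rfl h0.symm _ ((H.s_arr_eq hx).trans (Z.rng_act _ _).symm)
      _ = Z.act (s _ ⟨_, V.face_mem (ε 1) j x hx⟩) (c.1.1 j ⟨x, hx⟩ * _) := by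
        rw [Z.lact_act _ _ _ _ (H.s_arr_eq hx), H.lact_s j x hx, Z.act_act]
        rfl
  exact (eq_inv_mul_iff_mul_eq.2 hc).trans (mul_assoc _ _ _).symm

theorem mk_eq {U U₁ : NerveCover.Adm G} {s s₁ c c₁} (H : Z.IsTransition U.cov.nat s c)
    (H₁ : Z'.IsTransition U₁.cov.nat s₁ c₁) (i : Iso Z Z') :
    CechHR1.mk U c = CechHR1.mk U₁ c₁ :=
  have h := (H.map i).refine (NerveCover.prodFst U.cov U₁.cov).nat
  have h₁ := H₁.refine (NerveCover.prodSnd U.cov U₁.cov).nat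
  calc CechHR1.mk U c
    _ = CechHR1.mk (U.prod U₁) ((NerveCover.prodFst U.cov U₁.cov).nat.cocycle c) :=
      (CechHR1.of_map (W := U.prod U₁) (NerveCover.prodFst U.cov U₁.cov) _).symm
    _ = CechHR1.mk (U.prod U₁) ((NerveCover.prodSnd U.cov U₁.cov).nat.cocycle c₁) :=
      congrArg (CechHR1.of (U.prod U₁)) (Quotient.sound (h.equiv h₁))
    _ = CechHR1.mk U₁ c₁ :=
      CechHR1.of_map (W := U.prod U₁) (NerveCover.prodSnd U.cov U₁.cov) (Quotient.mk _ c₁)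

theorem homMk_eq {U : NerveCover G} {s s₁ c c₁} (H : Z.IsTransition U.nat s c)
    (H₁ : Z'.IsTransition U.nat s₁ c₁) (h : c ≈ c₁) : HomRG.mk Z = HomRG.mk Z' :=
  have ⟨_, H₂⟩ := H.exists_of_equiv h
  Quotient.sound (H₂.nonempty_iso H₁)

end IsTransition

variable (Z) in
/-- The Čech class of the transition cocycles of a Real generalized homomorphism. -/
noncomputable def cechClass : CechHR1 G S :=
  CechHR1.mk Z.exists_isTransition.choose Z.exists_isTransition.choose_spec.choose_spec.choose

theorem cechClass_eq_mk {U : NerveCover.Adm G} {s c} (H : Z.IsTransition U.cov.nat s c) :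
    Z.cechClass = CechHR1.mk U c :=
  Z.exists_isTransition.choose_spec.choose_spec.choose_spec.mk_eq H (Setoid.refl Z).some

theorem Iso.cechClass_eq (i : Iso Z Z') : Z.cechClass = Z'.cechClass :=
  have ⟨_, _, _, H⟩ := Z.exists_isTransition
  (cechClass_eq_mk H).trans (cechClass_eq_mk (H.map i)).symm

end Group

section CommGroup

variable {G : RealGroupoid.{u}} {S : Type u} [CommGroup S] [TopologicalSpace S] [RealGroup S]
  {Z Z' : RealGenHom G (ofGroup S)} {V : PreSimplicialCover G}
  {s : ∀ j : (V.cov 0).J, C((V.cov 0).U j, Z.Z)} {s' : ∀ j : (V.cov 0).J, C((V.cov 0).U j, Z'.Z)}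
  {c c' : V.ZR1 S}

theorem IsTransition.exists_sum (H : Z.IsTransition V s c) (H' : Z'.IsTransition V s' c') :
    ∃ t, (Z.sum Z').IsTransition V t (c * c') := by
  have hrng (j x) : Z.rng (s j x) = Z'.rng (s' j x) := (H.rng_s j x).trans (H'.rng_s j x).symm
  refine ⟨fun j => ⟨fun x => RealBibundle.sumMk _ _ ⟨(s j x, s' j x), hrng j x⟩,
    (RealBibundle.isOpenQuotientMap_sumMk _ _).continuous.comp
      (((s j).continuous.prodMk (s' j).continuous).subtype_mk _)⟩, H.rng_s,
    fun j x hx => ?_, fun j x hx _ => ?_⟩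
  · exact congrArg (RealBibundle.sumMk _ _)
      (Subtype.ext (Prod.ext (H.s_bar j x hx) (H'.s_bar j x hx)))
  · refine RealBibundle.sumMk_eq (c.1.1 j ⟨x, hx⟩) ?_ ?_
    · refine Eq.trans ?_ (congrArg (Z.act · _) (H.lact_s j x hx (H.s_arr_eq hx))).symm
      rw [Z.act_act, mul_inv_cancel, Z.act_one]
    · refine Eq.trans ?_ (congrArg (Z'.act · _) (H'.lact_s j x hx (H'.s_arr_eq hx))).symm
      rw [Z'.act_act, mul_comm]
      rfl

theorem IsTransition.inv (H : Z.IsTransition V s c) : Z.inv.IsTransition V s c⁻¹ where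
  rng_s := H.rng_s
  s_bar := H.s_bar
  lact_s j x hx e := (H.lact_s j x hx e).trans
    (congrArg (Z.act _) (inv_inv (c.1.1 j ⟨x, hx⟩)).symm)

end CommGroup

end RealGenHom

namespace HomRG

open RealGroupoid (ofGroup)
open NerveCover (arrowCocycle)

variable {G : RealGroupoid.{u}} {S : Type u}

section Group

variable [Group S] [TopologicalSpace S] [RealGroup S]

theorem mk_genHom_eq {U : NerveCover G} {c : U.nat.ZR1 S} {Z : RealGenHom G (ofGroup S)} {s c'}
    (H : Z.IsTransition U.nat s c') (h : c ≈ c') : mk (arrowCocycle c).genHom = mk Z :=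
  have ⟨_, Hc⟩ := RealGenHom.exists_isTransition_genHom c
  Hc.homMk_eq H h

/-- The isomorphism class of the bundles defined by the cocycles in a Čech class. -/
noncomputable def ofCech : CechHR1 G S → HomRG G (ofGroup S) :=
  Quot.lift (fun p => Quotient.lift (fun c => mk (arrowCocycle c).genHom)
    (fun _ c' h => have ⟨_, H⟩ := RealGenHom.exists_isTransition_genHom c'
      mk_genHom_eq H h) p.2) <| by
    rintro _ _ ⟨U, W, θ, x⟩
    induction x using Quotient.inductionOn with | _ c
    obtain ⟨_, H⟩ := RealGenHom.exists_isTransition_genHom c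
    exact (mk_genHom_eq (H.refine θ.nat) (Setoid.refl _)).symm

variable (G S) in
/-- The bijection between Real generalized homomorphisms to `S` and Real Čech classes. -/
noncomputable def equivCech : HomRG G (ofGroup S) ≃ CechHR1 G S where
  toFun := Quotient.lift RealGenHom.cechClass fun _ _ ⟨i⟩ => i.cechClass_eq
  invFun := ofCech
  left_inv z := by
    induction z using Quotient.inductionOn with | _ Z
    obtain ⟨U, s, c, H⟩ := Z.exists_isTransition
    exact (congrArg ofCech (RealGenHom.cechClass_eq_mk H)).trans
      (mk_genHom_eq H (Setoid.refl c))
  right_inv a := by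
    induction a using CechHR1.ind with | _ U x
    induction x using Quotient.inductionOn with | _ c
    obtain ⟨_, H⟩ := RealGenHom.exists_isTransition_genHom c
    exact RealGenHom.cechClass_eq_mk H

theorem equivCech_mk {Z : RealGenHom G (ofGroup S)} {U : NerveCover.Adm G} {s c}
    (H : Z.IsTransition U.cov.nat s c) : equivCech G S (mk Z) = CechHR1.mk U c :=
  RealGenHom.cechClass_eq_mk H

end Group

section CommGroup

variable [CommGroup S] [TopologicalSpace S] [RealGroup S]

theorem equivCech_sum (Z Z' : RealGenHom G (ofGroup S)) :
    equivCech G S (mk (Z.sum Z')) = equivCech G S (mk Z) * equivCech G S (mk Z') := by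
  obtain ⟨U, s, c, H⟩ := Z.exists_isTransition
  obtain ⟨U', s', c', H'⟩ := Z'.exists_isTransition
  have h := H.refine (NerveCover.prodFst U.cov U'.cov).nat
  have h' := H'.refine (NerveCover.prodSnd U.cov U'.cov).nat
  obtain ⟨t, ht⟩ := h.exists_sum h'
  rw [equivCech_mk (U := U.prod U') ht, equivCech_mk (U := U.prod U') h,
    equivCech_mk (U := U.prod U') h']
  exact (CechHR1.of_mul (S := S) (U.prod U') (Quotient.mk _ _) (Quotient.mk _ _)).symm

theorem equivCech_inv (Z : RealGenHom G (ofGroup S)) :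
    equivCech G S (mk Z.inv) = (equivCech G S (mk Z))⁻¹ := by
  obtain ⟨U, s, c, H⟩ := Z.exists_isTransition
  exact (equivCech_mk H.inv).trans (congrArg Inv.inv (equivCech_mk H)).symm

end CommGroup

end HomRG

theorem mainTheorem4 (G : RealGroupoid.{u}) :
    (∀ (S : Type u) [CommGroup S] [TopologicalSpace S] [RealGroup S],
      ∃ _ : CommGroup (HomRG G (RealGroupoid.ofGroup S)),
        (∀ Z Z' : RealGenHom G (RealGroupoid.ofGroup S),
          HomRG.mk Z * HomRG.mk Z' = HomRG.mk (Z.sum Z')) ∧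
        (∀ Z : RealGenHom G (RealGroupoid.ofGroup S), (HomRG.mk Z)⁻¹ = HomRG.mk Z.inv) ∧
        ∃ e : HomRG G (RealGroupoid.ofGroup S) ≃* CechHR1 G S,
          ∀ Z : RealGenHom G (RealGroupoid.ofGroup S),
            (∃ (U : NerveCover.Adm G) (s : _) (c : _), Z.IsTransition U.cov.nat s c) ∧
            ∀ (U : NerveCover.Adm G) (s : _) (c : _), Z.IsTransition U.cov.nat s c →
              e (HomRG.mk Z) = CechHR1.mk U c) ∧
    (∀ (S : Type u) [Group S] [TopologicalSpace S] [RealGroup S],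
      ∃ e : HomRG G (RealGroupoid.ofGroup S) ≃ CechHR1 G S,
        ∀ Z : RealGenHom G (RealGroupoid.ofGroup S),
          (∃ (U : NerveCover.Adm G) (s : _) (c : _), Z.IsTransition U.cov.nat s c) ∧
          ∀ (U : NerveCover.Adm G) (s : _) (c : _), Z.IsTransition U.cov.nat s c →
            e (HomRG.mk Z) = CechHR1.mk U c) := by
  refine ⟨fun S _ _ _ => ?_, fun S _ _ _ => ⟨HomRG.equivCech G S, fun Z =>
    ⟨Z.exists_isTransition, fun U s c H => HomRG.equivCech_mk H⟩⟩⟩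
  let e := HomRG.equivCech G S
  let _ := e.commGroup
  refine ⟨e.commGroup, fun Z Z' => ?_, fun Z => ?_, e.mulEquiv, fun Z =>
    ⟨Z.exists_isTransition, fun U s c H => HomRG.equivCech_mk H⟩⟩
  · exact e.symm_apply_eq.2 (HomRG.equivCech_sum Z Z').symm
  · exact e.symm_apply_eq.2 (HomRG.equivCech_inv Z).symm
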